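/- Let $a$, $b$ and $q$ be independent indeterminates. For an integer $m$ put $[m]=(1-q^m)/(1-q)$, let $\Phi_n(q)$ be the $n$-th cyclotomic polynomial in $q$, and write $(x;q)_k=\prod_{i=0}^{k-1}(1-xq^{i})$ for integers $k\ge 0$, with $(x_1,\dots,x_m;q)_k=(x_1;q)_k\cdots(x_m;q)_k$. For a polynomial $P\in\mathbb{Q}(a,b)[q]$ and a rational function $R\in\mathbb{Q}(a,b)(q)$, write $R\equiv 0\pmod{P}$ if $P$ divides, in $\mathbb{Q}(a,b)[q]$, the numerator of $R$ in lowest terms. **Theorem 1.2.** Let $n>1$ and $d\ge 3$ be integers with $\gcd(n,d)=1$. Then $$\sum_{k=0}^{n-1}[2dk-1]\,\frac{(aq^{-1},q^{-1}/a,bq^{-1},q^{-1}/b;q^d)_k\,(q^{-1};q^d)_k^2}{(aq^d,q^d/a,bq^d,q^d/b;q^d)_k\,(q^d;q^d)_k^2}\,q^{(2d+3)k}\equiv\begin{cases}0 \pmod{[n]\Phi_n(q)}, & \text{if } n\equiv 1\pmod d,\\ 0\pmod{[n]}, & \text{otherwise.}\end{cases}$$ -/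

import Mathlib

open Polynomial Finset

namespace QSupercongruence

/-- The `q`-shifted factorial `(x; q)_k = (1 - x) (1 - x q) ⋯ (1 - x q^(k-1))`. -/
def qPochhammer {F : Type*} [CommRing F] (x q : F) (k : ℕ) : F :=
  ∏ i ∈ range k, (1 - x * q ^ i)

/-- The `q`-integer `[m] = (1 - q^m) / (1 - q)` for an arbitrary integer `m`. -/
def qInt {F : Type*} [Field F] (q : F) (m : ℤ) : F :=
  (1 - q ^ m) / (1 - q)

/-- The `q`-integer `[n] = 1 + q + ⋯ + q^(n-1)` as a polynomial in `q`. -/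
noncomputable def qNat (K : Type*) [Field K] (n : ℕ) : K[X] :=
  ∑ i ∈ range n, X ^ i

/-- The polynomial `[n]`, seen as a rational function, is `(1 - q^n) / (1 - q)`. -/
theorem algebraMap_qNat (K : Type*) [Field K] (n : ℕ) :
    algebraMap K[X] (RatFunc K) (qNat K n) = qInt (RatFunc.X : RatFunc K) n := by
  have h1 : (1 : K[X]) - X ≠ 0 := by
    intro h
    have := congrArg (fun p : K[X] => p.coeff 0) h
    simp at this
  have h2 : (1 : RatFunc K) - RatFunc.X ≠ 0 := by
    have h := (map_ne_zero_iff (algebraMap K[X] (RatFunc K))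
      (RatFunc.algebraMap_injective K)).2 h1
    simpa [RatFunc.algebraMap_X] using h
  rw [qInt, eq_div_iff h2, qNat, map_sum]
  simp only [map_pow, RatFunc.algebraMap_X, zpow_natCast]
  exact geom_sum_mul_neg _ _

/-- Congruence of two rational functions in `q` over the field `K`, modulo a polynomial `P` in `q`:
the numerator of the difference, written in lowest terms, is divisible by `P`.  (The denominator
is then automatically coprime to `P`.) -/
def RatCongr {K : Type*} [Field K] (P : K[X]) (x y : RatFunc K) : Prop :=
  P ∣ (x - y).num

/-- The field `ℚ(a, b)` of rational functions in two indeterminates `a`, `b`. -/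
abbrev ParamField : Type := FractionRing (MvPolynomial (Fin 2) ℚ)

/-- The field `ℚ(a, b)(q)` of rational functions in `q` over `ℚ(a, b)`. -/
abbrev QField : Type := RatFunc ParamField

/-- The indeterminate `a`, as an element of `ℚ(a, b)(q)`. -/
noncomputable def indA : QField :=
  RatFunc.C (algebraMap (MvPolynomial (Fin 2) ℚ) ParamField (MvPolynomial.X 0))

/-- The indeterminate `b`, as an element of `ℚ(a, b)(q)`. -/
noncomputable def indB : QField :=
  RatFunc.C (algebraMap (MvPolynomial (Fin 2) ℚ) ParamField (MvPolynomial.X 1))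

/-- The indeterminate `q`, as an element of `ℚ(a, b)(q)`. -/
noncomputable def indQ : QField := RatFunc.X

/-- The sum `∑_{k=0}^{n-1} [2dk-1] (a q⁻¹, q⁻¹/a, b q⁻¹, q⁻¹/b; q^d)_k (q⁻¹; q^d)_k² /
((a q^d, q^d/a, b q^d, q^d/b; q^d)_k (q^d; q^d)_k²) q^((2d+3)k)` in a field `F`. -/
def truncatedSum {F : Type*} [Field F] (a b q : F) (n d : ℕ) : F :=
  ∑ k ∈ range n,
    qInt q (2 * (d : ℤ) * (k : ℤ) - 1) *
      ((qPochhammer (a * q⁻¹) (q ^ d) k * qPochhammer (q⁻¹ / a) (q ^ d) k *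
          qPochhammer (b * q⁻¹) (q ^ d) k * qPochhammer (q⁻¹ / b) (q ^ d) k *
          qPochhammer q⁻¹ (q ^ d) k ^ 2) /
        (qPochhammer (a * q ^ d) (q ^ d) k * qPochhammer (q ^ d / a) (q ^ d) k *
          qPochhammer (b * q ^ d) (q ^ d) k * qPochhammer (q ^ d / b) (q ^ d) k *
          qPochhammer (q ^ d) (q ^ d) k ^ 2)) *
      q ^ ((2 * d + 3) * k)

end QSupercongruence

/-!
Write `p = q^d` and `α = q⁻¹`.  Up to the factor `1 / (1 - q)` the summand is the `k`-th term of a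
very-well-poised `₈φ₇` in base `p` with leading parameter `α` and further parameters
`a α, α / a, b α, α / b, α`.

*Modulo `[n]`.*  Let `m > 1` divide `n` and let `0 ≤ r < m` with `d r ≡ 1` modulo `m`.  Modulo `Φ_m`
one has `q^m = 1`, hence `α = p⁻ʳ`.  A very-well-poised term with leading parameter `p⁻ʳ` changes
sign under `k ↦ r - k` (`vwpTerm_reflect`), so the terms with `0 ≤ k ≤ r` cancel in pairs, while
those with `r < k < m` contain the factor `1 - q^(d r - 1)` twice (`locDvd_two_paramTerm`).  Hence
the sum over one period `0 ≤ k < m` vanishes modulo `Φ_m`; passing from one period to the next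
multiplies every term by the same quantity, which has no pole at `Φ_m`
(`exists_locCongr_paramTerm`), so the whole sum vanishes modulo `Φ_m`.  The polynomial `[n]` is the
product of these pairwise coprime `Φ_m`.

*Modulo `Φ_n^2`, for `n = d s + 1`.*  Now `r = n - s`.  Let `F(w, v)` be the sum over `0 ≤ k ≤ r`
with leading parameter `q^w` and last parameter `q^v`, the other four parameters being fixed.  The
exponents `-1` and `-d r` agree modulo `n`, so modulo `Φ_n^2` the mixed difference
`F(-1, -1) - F(-1, -d r) - F(-d r, -1) + F(-d r, -d r)` vanishes (`LocBiCongr.mixed`).  The last two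
values are zero by antisymmetry, for any last parameter (`sum_vwpTerm_reflect`).  The second
one is a terminating series to which Watson's transformation applies (`sum_vwpTerm_eq`): in each
term on the other side, `(α; p)_{r+1}` contains `1 - q^(d r - 1)`, and one of
`(p / α; p)_j`, `(p / α; p)_{r-j}` contains `1 - q^(d s + 1)`, because `d ≥ 3` forces
`2 s ≤ r + 1`.  Both are multiples of `Φ_n` (`locDvd_two_sum_paramTerm_watson`).

Watson's transformation follows from the `q`-Pfaff–Saalschütz sum and the terminating `₆φ₅` sum,
and each of these by induction on the length, from a contiguous relation between consecutive
lengths.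
-/

namespace QSupercongruence

/-! ### Terminating `q`-hypergeometric sums -/

section Identities

variable {F : Type*} [Field F]

theorem qPochhammer_zero (x p : F) : qPochhammer x p 0 = 1 := by simp [qPochhammer]

theorem qPochhammer_succ (x p : F) (k : ℕ) :
    qPochhammer x p (k + 1) = qPochhammer x p k * (1 - x * p ^ k) :=
  prod_range_succ _ _

theorem qPochhammer_add (x p : F) (j i : ℕ) :
    qPochhammer x p (j + i) = qPochhammer x p j * qPochhammer (x * p ^ j) p i := by
  simp only [qPochhammer, prod_range_add]
  congr 1
  exact prod_congr rfl fun l _ => by ring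

theorem qPochhammer_succ' (x p : F) (k : ℕ) :
    qPochhammer x p (k + 1) = (1 - x) * qPochhammer (x * p) p k := by
  rw [add_comm, qPochhammer_add, qPochhammer_succ, qPochhammer_zero]
  simp

theorem qPochhammer_ne_zero {x p : F} (h : ∀ i, x * p ^ i ≠ 1) (k : ℕ) :
    qPochhammer x p k ≠ 0 :=
  prod_ne_zero_iff.2 fun i _ => sub_ne_zero.2 (h i).symm

/-- Passing to `(x p; p)_k` keeps the factors nonzero. -/
theorem mul_pow_ne_one_of_shift {x p : F} (h : ∀ i, x * p ^ i ≠ 1) (i : ℕ) : x * p * p ^ i ≠ 1 := by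
  rw [mul_assoc, ← pow_succ']
  exact h _

theorem qPochhammer_inv_pow_eq_zero {p : F} (hp : p ≠ 0) (k : ℕ) :
    qPochhammer (p ^ k)⁻¹ p (k + 1) = 0 := by
  rw [qPochhammer_succ, inv_mul_cancel₀ (pow_ne_zero _ hp)]
  simp


/-- The shape shared by the two inductions below: if the summands `f` and `g` differ by a multiple
of a shifted summand `h`, then so do the sums. -/
theorem sum_range_succ_of_step {f g h : ℕ → F} {c : F} {k : ℕ} (h0 : f 0 = g 0)
    (hstep : ∀ j, f (j + 1) = g (j + 1) + c * h j) (hg : g (k + 1) = 0) :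
    ∑ j ∈ range (k + 2), f j = ∑ j ∈ range (k + 1), g j + c * ∑ j ∈ range (k + 1), h j := by
  have : ∑ j ∈ range (k + 1), g j = ∑ j ∈ range (k + 2), g j := by
    rw [sum_range_succ g (k + 1), hg, add_zero]
  rw [this, sum_range_succ', sum_range_succ' g, sum_congr rfl fun j _ => hstep j,
    sum_add_distrib, ← mul_sum, h0]
  ring

/-- The `j`-th term of the basic hypergeometric series `₃φ₂(u, v, x; B, C; p, p)`. -/
def threePhiTwoTerm (p u v x B C : F) (j : ℕ) : F :=
  qPochhammer u p j * qPochhammer v p j * qPochhammer x p j /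
    (qPochhammer p p j * qPochhammer B p j * qPochhammer C p j) * p ^ j

/-- Replacing `(u, v)` by `(u / p, v p)` changes a `₃φ₂` by a multiple of a shifted `₃φ₂`. -/
theorem threePhiTwoTerm_contiguous {p B C : F} (hp : p ≠ 0) (hp1 : ∀ i, p * p ^ i ≠ 1)
    (hB : ∀ i, B * p ^ i ≠ 1) (hC : ∀ i, C * p ^ i ≠ 1) (u v x : F) (j : ℕ) :
    threePhiTwoTerm p (u / p) (v * p) x B C (j + 1) =
      threePhiTwoTerm p u v x B C (j + 1) +
        (v - u / p) * (1 - x) * p / ((1 - B) * (1 - C)) *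
          threePhiTwoTerm p u (v * p) (x * p) (B * p) (C * p) j := by
  have hB0 : 1 - B ≠ 0 := sub_ne_zero.2 (by simpa using (hB 0).symm)
  have hC0 : 1 - C ≠ 0 := sub_ne_zero.2 (by simpa using (hC 0).symm)
  have h1 := qPochhammer_ne_zero hp1 j
  have h2 := qPochhammer_ne_zero (mul_pow_ne_one_of_shift hB) j
  have h3 := qPochhammer_ne_zero (mul_pow_ne_one_of_shift hC) j
  have h4 : 1 - p * p ^ j ≠ 0 := sub_ne_zero.2 (hp1 j).symm
  simp only [threePhiTwoTerm]
  rw [qPochhammer_succ' (u / p), qPochhammer_succ (v * p), qPochhammer_succ u,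
    qPochhammer_succ' v, qPochhammer_succ' x, qPochhammer_succ p, qPochhammer_succ' B,
    qPochhammer_succ' C, div_mul_cancel₀ u hp]
  field_simp
  ring

/-- The `q`-Pfaff–Saalschütz sum. -/
theorem sum_threePhiTwoTerm {p : F} (hp : p ≠ 0) (hp1 : ∀ i, p * p ^ i ≠ 1) (k : ℕ) :
    ∀ {B C x : F}, x ≠ 0 → (∀ i, B * p ^ i ≠ 1) → (∀ i, C * p ^ i ≠ 1) →
    ∑ j ∈ range (k + 1), threePhiTwoTerm p (p ^ k)⁻¹ (B * C / (p * x) * p ^ k) x B C j =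
      qPochhammer (C / x) p k * qPochhammer (B / x) p k * x ^ k /
        (qPochhammer B p k * qPochhammer C p k) := by
  induction k with
  | zero => intros; simp [qPochhammer_zero, threePhiTwoTerm]
  | succ k ih =>
    intro B C x hx hB hC
    have hB' := mul_pow_ne_one_of_shift hB
    have hC' := mul_pow_ne_one_of_shift hC
    have hB0 : 1 - B ≠ 0 := sub_ne_zero.2 (by simpa using (hB 0).symm)
    have hC0 : 1 - C ≠ 0 := sub_ne_zero.2 (by simpa using (hC 0).symm)
    have hpk : p ^ k ≠ 0 := pow_ne_zero _ hp
    have ih1 := ih hx hB hC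
    have ih2 := ih (mul_ne_zero hx hp) hB' hC'
    have e1 : (p ^ (k + 1))⁻¹ = (p ^ k)⁻¹ / p := by rw [pow_succ]; field_simp
    have e2 : B * p * (C * p) / (p * (x * p)) * p ^ k = B * C / (p * x) * p ^ k * p := by
      field_simp
    have e3 : B * C / (p * x) * p ^ (k + 1) = B * C / (p * x) * p ^ k * p := by ring
    rw [e2] at ih2
    rw [e1, e3, sum_range_succ_of_step (by simp [threePhiTwoTerm, qPochhammer_zero])
      (threePhiTwoTerm_contiguous hp hp1 hB hC _ _ x)
      (by simp [threePhiTwoTerm, qPochhammer_inv_pow_eq_zero hp]), ih1, ih2]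
    have h2 := qPochhammer_ne_zero hB k
    have h3 := qPochhammer_ne_zero hC k
    have h4 : 1 - B * p ^ k ≠ 0 := sub_ne_zero.2 (hB k).symm
    have h5 : 1 - C * p ^ k ≠ 0 := sub_ne_zero.2 (hC k).symm
    have sB : qPochhammer (B * p) p k = qPochhammer B p k * (1 - B * p ^ k) / (1 - B) := by
      rw [eq_div_iff hB0, ← qPochhammer_succ, qPochhammer_succ']; ring
    have sC : qPochhammer (C * p) p k = qPochhammer C p k * (1 - C * p ^ k) / (1 - C) := by
      rw [eq_div_iff hC0, ← qPochhammer_succ, qPochhammer_succ']; ring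
    rw [sB, sC, mul_div_mul_right _ _ hp, mul_div_mul_right _ _ hp, qPochhammer_succ B,
      qPochhammer_succ C, qPochhammer_succ, qPochhammer_succ]
    field_simp
    ring

/-- The `i`-th term, multiplied by `1 - α`, of the very-well-poised series
`₆φ₅(α, √α p, -√α p, d, e, w; √α, -√α, α p / d, α p / e, y; p, z)`. -/
def sixPhiFiveTerm (p α d e w y z : F) (i : ℕ) : F :=
  (1 - α * p ^ (2 * i)) * (qPochhammer α p i * qPochhammer d p i * qPochhammer e p i *
    qPochhammer w p i) / (qPochhammer p p i * qPochhammer (α * p / d) p i *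
      qPochhammer (α * p / e) p i * qPochhammer y p i) * z ^ i

/-- Passing from `(w, y, z)` to `(w / p, y p, z p)`, that is, from `N` to `N + 1` when `w = p⁻ᴺ`,
changes a `₆φ₅` by a multiple of the `₆φ₅` with `(α, d, e)` replaced by `(α p², d p, e p)`. -/
theorem sixPhiFiveTerm_contiguous {p α d e w y z : F} (hp : p ≠ 0) (hp1 : ∀ i, p * p ^ i ≠ 1)
    (hd : ∀ i, α * p / d * p ^ i ≠ 1) (he : ∀ i, α * p / e * p ^ i ≠ 1)
    (hd0 : d ≠ 0) (he0 : e ≠ 0)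
    (hy : ∀ i, y * p ^ i ≠ 1) (hwy : w * y = α * p) (i : ℕ) :
    sixPhiFiveTerm p α d e (w / p) (y * p) (z * p) (i + 1) =
      sixPhiFiveTerm p α d e w y z (i + 1) +
        -(z * (1 - α) * (1 - α * p) * (1 - d) * (1 - e) /
          ((1 - α * p / d) * (1 - α * p / e) * (1 - y) * (1 - y * p))) *
          sixPhiFiveTerm p (α * p ^ 2) (d * p) (e * p) w (y * p ^ 2) z i := by
  have hd1 : 1 - α * p / d ≠ 0 := sub_ne_zero.2 (by simpa using (hd 0).symm)
  have he1 : 1 - α * p / e ≠ 0 := sub_ne_zero.2 (by simpa using (he 0).symm)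
  have hy0 : 1 - y ≠ 0 := sub_ne_zero.2 (by simpa using (hy 0).symm)
  have hy1 : 1 - y * p ≠ 0 := sub_ne_zero.2 (by simpa using (hy 1).symm)
  have hyi : 1 - y * p * p ^ i ≠ 0 :=
    sub_ne_zero.2 (by simpa [pow_succ', mul_assoc] using (hy (i + 1)).symm)
  have hy2 := mul_pow_ne_one_of_shift (mul_pow_ne_one_of_shift hy)
  have h1 := qPochhammer_ne_zero hp1 i
  have h2 := qPochhammer_ne_zero (mul_pow_ne_one_of_shift hd) i
  have h3 := qPochhammer_ne_zero (mul_pow_ne_one_of_shift he) i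
  have h5 := qPochhammer_ne_zero hy2 i
  have h4 : 1 - p * p ^ i ≠ 0 := sub_ne_zero.2 (hp1 i).symm
  have ed : α * p ^ 2 * p / (d * p) = α * p / d * p := by field_simp
  have ee : α * p ^ 2 * p / (e * p) = α * p / e * p := by field_simp
  have ey : y * p ^ 2 = y * p * p := by ring
  have s1 : qPochhammer α p (i + 1) * (1 - α * p * p ^ i) =
      (1 - α) * (1 - α * p) * qPochhammer (α * p ^ 2) p i := by
    have := qPochhammer_succ α p (i + 1)
    rw [qPochhammer_succ' α, qPochhammer_succ' (α * p)] at this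
    rw [show α * p * p ^ i = α * p ^ (i + 1) by ring, ← this,
      show α * p ^ 2 = α * p * p by ring]
    ring
  have s2 : qPochhammer (y * p) p (i + 1) = (1 - y * p) * qPochhammer (y * p * p) p i :=
    qPochhammer_succ' _ _ _
  have s3 : qPochhammer y p (i + 1) =
      (1 - y) * (1 - y * p) * qPochhammer (y * p * p) p i / (1 - y * p * p ^ i) := by
    rw [eq_div_iff hyi, show y * p * p ^ i = y * p ^ (i + 1) by ring, ← qPochhammer_succ,
      qPochhammer_succ', qPochhammer_succ']
    ring
  have s4 : qPochhammer (w / p) p (i + 1) = (1 - w / p) * qPochhammer w p i := by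
    rw [qPochhammer_succ', div_mul_cancel₀ w hp]
  simp only [sixPhiFiveTerm]
  rw [s2, s3, s4, ed, ee, ey, qPochhammer_succ p, qPochhammer_succ' d, qPochhammer_succ' e,
    qPochhammer_succ' (α * p / d), qPochhammer_succ' (α * p / e), qPochhammer_succ w]
  rw [show α * p ^ 2 * p ^ (2 * i) = α * p ^ (2 * (i + 1)) by ring]
  -- The polynomial identity behind the relation; its right side cancels the last factor of
  -- `(p; p)_{i+1}` and extends `(α; p)_{i+1}` by one factor.
  have key : (1 - w / p) * p ^ (i + 1) * (1 - y) - (1 - w * p ^ i) * (1 - y * p * p ^ i) =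
      -((1 - p * p ^ i) * (1 - α * p * p ^ i)) := by
    have hw : w / p * p ^ (i + 1) = w * p ^ i := by rw [pow_succ']; field_simp
    linear_combination (-1 + y) * hw + (p ^ i - p ^ i * p ^ i * p) * hwy
  generalize qPochhammer α p (i + 1) = A at *
  generalize qPochhammer (α * p ^ 2) p i = A' at *
  generalize qPochhammer p p i = P1 at *
  generalize qPochhammer (α * p / d * p) p i = P2 at *
  generalize qPochhammer (α * p / e * p) p i = P3 at *
  generalize qPochhammer (y * p * p) p i = P4 at *
  generalize α * p / d = D at *
  generalize α * p / e = E at *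
  generalize 1 - α * p ^ (2 * (i + 1)) = G at *
  generalize 1 - w / p = W at *
  generalize 1 - w * p ^ i = W' at *
  generalize 1 - α * p * p ^ i = a at *
  generalize 1 - y * p * p ^ i = b at *
  generalize 1 - y * p = Y1 at *
  generalize 1 - y = Y0 at *
  generalize 1 - D = D1 at *
  generalize 1 - E = E1 at *
  generalize 1 - p * p ^ i = h at *
  generalize qPochhammer (d * p) p i = A2
  generalize qPochhammer (e * p) p i = A3
  generalize qPochhammer w p i = A4
  generalize 1 - d = d1
  generalize 1 - e = e1
  generalize 1 - α = a0 at *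
  generalize 1 - α * p = a1 at *
  clear hd he hy hy2 hp1 ed ee ey s2 s3 s4
  obtain ⟨S, hS⟩ : ∃ S : F, S = G * (d1 * A2) * (e1 * A3) * A4 * z ^ (i + 1) /
    (P1 * (D1 * P2) * (E1 * P3) * (Y1 * P4)) := ⟨_, rfl⟩
  have t1 : G * (A * (d1 * A2) * (e1 * A3) * (W * A4)) /
      (P1 * h * (D1 * P2) * (E1 * P3) * (Y1 * P4)) * (z * p) ^ (i + 1) =
      S * (A * W * p ^ (i + 1)) / h := by
    rw [hS]; ring
  have t2 : G * (A * (d1 * A2) * (e1 * A3) * (A4 * W')) /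
      (P1 * h * (D1 * P2) * (E1 * P3) * (Y0 * Y1 * P4 / b)) * z ^ (i + 1) =
      S * (A * W' * b) / (h * Y0) := by
    rw [hS]
    simp only [div_eq_mul_inv, mul_inv, inv_inv]
    ring
  have t3 : -(z * a0 * a1 * d1 * e1 / (D1 * E1 * Y0 * Y1)) *
      (G * (A' * A2 * A3 * A4) / (P1 * P2 * P3 * P4) * z ^ i) =
      -(S * (a0 * a1 * A') / Y0) := by
    rw [hS]; ring
  have t4 : A * W * p ^ (i + 1) * Y0 = A * W' * b - a0 * a1 * A' * h := by
    linear_combination A * key - h * s1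
  rw [t1, t2, t3, div_eq_iff h4]
  apply mul_right_cancel₀ hy0
  trans S * (A * W * p ^ (i + 1) * Y0)
  · ring
  · rw [t4]
    field_simp
    ring

/-- The terminating very-well-poised `₆φ₅` sum. -/
theorem sum_sixPhiFiveTerm {p : F} (hp : p ≠ 0) (hp1 : ∀ i, p * p ^ i ≠ 1) (N : ℕ) :
    ∀ {α d e : F}, d ≠ 0 → e ≠ 0 → (∀ i, α * p / d * p ^ i ≠ 1) →
    (∀ i, α * p / e * p ^ i ≠ 1) → (∀ i, α * p * p ^ i ≠ 1) →
    ∑ i ∈ range (N + 1), sixPhiFiveTerm p α d e (p ^ N)⁻¹ (α * p * p ^ N)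
        (α * p * p ^ N / (d * e)) i =
      qPochhammer α p (N + 1) * qPochhammer (α * p / (d * e)) p N /
        (qPochhammer (α * p / d) p N * qPochhammer (α * p / e) p N) := by
  induction N with
  | zero => intros; simp [qPochhammer_zero, sixPhiFiveTerm, qPochhammer_succ]
  | succ N ih =>
    intro α d e hd0 he0 hd he hα
    have hpN : p ^ N ≠ 0 := pow_ne_zero _ hp
    have hy : ∀ i, α * p * p ^ N * p ^ i ≠ 1 := fun i => by
      rw [mul_assoc _ (p ^ N), ← pow_add]; exact hα _
    have ed : α * p ^ 2 * p / (d * p) = α * p / d * p := by field_simp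
    have ee : α * p ^ 2 * p / (e * p) = α * p / e * p := by field_simp
    have ede : α * p ^ 2 * p / (d * p * (e * p)) = α * p / (d * e) := by field_simp
    have ih1 := ih hd0 he0 hd he hα
    have ih2 := ih (α := α * p ^ 2) (mul_ne_zero hd0 hp) (mul_ne_zero he0 hp)
      (by rw [ed]; exact mul_pow_ne_one_of_shift hd)
      (by rw [ee]; exact mul_pow_ne_one_of_shift he)
      (by
        rw [show α * p ^ 2 * p = α * p * p * p by ring]
        exact mul_pow_ne_one_of_shift (mul_pow_ne_one_of_shift hα))
    have e1 : (p ^ (N + 1))⁻¹ = (p ^ N)⁻¹ / p := by rw [pow_succ]; field_simp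
    have e2 : α * p * p ^ (N + 1) = α * p * p ^ N * p := by ring
    have e3 : α * p * p ^ N * p / (d * e) = α * p * p ^ N / (d * e) * p := by ring
    have e4 : α * p ^ 2 * p * p ^ N = α * p * p ^ N * p ^ 2 := by ring
    have e5 : α * p * p ^ N * p ^ 2 / (d * p * (e * p)) = α * p * p ^ N / (d * e) := by
      field_simp
    rw [ed, ee, ede, e4, e5] at ih2
    rw [e1, e2, e3, sum_range_succ_of_step (by simp [sixPhiFiveTerm, qPochhammer_zero])
      (sixPhiFiveTerm_contiguous hp hp1 hd he hd0 he0 hy (by field_simp))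
      (by simp [sixPhiFiveTerm, qPochhammer_inv_pow_eq_zero hp]), ih1, ih2]
    have hd1 : 1 - α * p / d ≠ 0 := sub_ne_zero.2 (by simpa using (hd 0).symm)
    have he1 : 1 - α * p / e ≠ 0 := sub_ne_zero.2 (by simpa using (he 0).symm)
    have hy0 : 1 - α * p * p ^ N ≠ 0 := sub_ne_zero.2 (hα N).symm
    have hy1 : 1 - α * p * p ^ N * p ≠ 0 := sub_ne_zero.2 (by simpa using (hy 1).symm)
    have hdN : 1 - α * p / d * p ^ N ≠ 0 := sub_ne_zero.2 (hd N).symm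
    have heN : 1 - α * p / e * p ^ N ≠ 0 := sub_ne_zero.2 (he N).symm
    have h2 := qPochhammer_ne_zero hd N
    have h3 := qPochhammer_ne_zero he N
    have sd : qPochhammer (α * p / d * p) p N =
        qPochhammer (α * p / d) p N * (1 - α * p / d * p ^ N) / (1 - α * p / d) := by
      rw [eq_div_iff hd1, ← qPochhammer_succ, qPochhammer_succ']; ring
    have se : qPochhammer (α * p / e * p) p N =
        qPochhammer (α * p / e) p N * (1 - α * p / e * p ^ N) / (1 - α * p / e) := by
      rw [eq_div_iff he1, ← qPochhammer_succ, qPochhammer_succ']; ring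
    have sα : (1 - α) * (1 - α * p) * qPochhammer (α * p ^ 2) p (N + 1) =
        qPochhammer α p (N + 1) * (1 - α * p * p ^ N) * (1 - α * p * p ^ N * p) := by
      rw [show α * p * p ^ N = α * p ^ (N + 1) by ring, ← qPochhammer_succ,
        show α * p ^ (N + 1) * p = α * p ^ (N + 1 + 1) by ring, ← qPochhammer_succ,
        qPochhammer_succ' α, qPochhammer_succ' (α * p), show α * p ^ 2 = α * p * p by ring]
      ring
    have sα' : qPochhammer (α * p ^ 2) p (N + 1) * ((1 - α) * (1 - α * p)) /
        ((1 - α * p * p ^ N) * (1 - α * p * p ^ N * p)) = qPochhammer α p (N + 1) := by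
      rw [div_eq_iff (mul_ne_zero hy0 hy1)]
      linear_combination sα
    rw [sd, se, qPochhammer_succ α p (N + 1), qPochhammer_succ (α * p / (d * e)) p N,
      qPochhammer_succ (α * p / d),
      qPochhammer_succ (α * p / e)]
    trans (qPochhammer α p (N + 1) * qPochhammer (α * p / (d * e)) p N /
        (qPochhammer (α * p / d) p N * qPochhammer (α * p / e) p N)) -
      (α * p * p ^ N / (d * e)) * (1 - d) * (1 - e) * qPochhammer (α * p / (d * e)) p N /
        (qPochhammer (α * p / d) p N * qPochhammer (α * p / e) p N *
          (1 - α * p / d * p ^ N) * (1 - α * p / e * p ^ N)) *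
      (qPochhammer (α * p ^ 2) p (N + 1) * ((1 - α) * (1 - α * p)) /
        ((1 - α * p * p ^ N) * (1 - α * p * p ^ N * p)))
    · rw [sub_eq_add_neg]
      generalize 1 - α * p / d = u1 at *
      generalize 1 - α * p / e = u2 at *
      generalize 1 - α * p / d * p ^ N = u3 at *
      generalize 1 - α * p / e * p ^ N = u4 at *
      generalize qPochhammer (α * p / d) p N = u5 at *
      generalize qPochhammer (α * p / e) p N = u6 at *
      generalize qPochhammer (α * p / (d * e)) p N = u7 at *
      generalize 1 - α * p * p ^ N = u8 at *
      generalize 1 - α * p * p ^ N * p = u9 at *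
      generalize α * p * p ^ N / (d * e) = u10 at *
      field_simp
      ring
    · rw [sα']
      generalize qPochhammer (α * p / d) p N = u5 at *
      generalize qPochhammer (α * p / e) p N = u6 at *
      generalize qPochhammer (α * p / (d * e)) p N = u7 at *
      rw [sub_eq_iff_eq_add]
      have key : (1 - α * p / d * p ^ N) * (1 - α * p / e * p ^ N) =
          (1 - α * p ^ (N + 1)) * (1 - α * p / (d * e) * p ^ N) +
            α * p * p ^ N / (d * e) * (1 - d) * (1 - e) := by
        field_simp
        ring
      generalize 1 - α * p / d * p ^ N = u3 at *
      generalize 1 - α * p / e * p ^ N = u4 at *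
      trans qPochhammer α p (N + 1) * u7 / (u5 * u6 * u3 * u4) * (u3 * u4)
      · field_simp
      · rw [key]
        ring

end Identities

/-! ### Watson's transformation -/

section WatsonTransformation

variable {F : Type*} [Field F]

/-- The quotient `(x; p)_k / (α p / x; p)_k` contributed by the parameter `x` to a well-poised
series with leading parameter `α`. -/
def wellPoised (α p x : F) (k : ℕ) : F :=
  qPochhammer x p k / qPochhammer (α * p / x) p k

/-- The `k`-th term, multiplied by `1 - α`, of the very-well-poised series
`₈φ₇(α, √α p, -√α p, b, c, d, e, f; √α, -√α, α p / b, …, α p / f; p, α² p² / (b c d e f))`. -/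
def vwpTerm (p α b c d e f : F) (k : ℕ) : F :=
  (1 - α * p ^ (2 * k)) *
    (wellPoised α p α k * wellPoised α p b k * wellPoised α p c k * wellPoised α p d k *
      wellPoised α p e k * wellPoised α p f k) * (α ^ 2 * p ^ 2 / (b * c * d * e * f)) ^ k

theorem sum_range_sum_range_succ (f : ℕ → ℕ → F) (N : ℕ) :
    ∑ k ∈ range (N + 1), ∑ j ∈ range (k + 1), f k j =
      ∑ j ∈ range (N + 1), ∑ i ∈ range (N - j + 1), f (j + i) j := by
  rw [sum_sigma', sum_sigma']
  refine sum_bij' (fun x _ => ⟨x.2, x.1 - x.2⟩) (fun y _ => ⟨y.1 + y.2, y.1⟩) ?_ ?_ ?_ ?_ ?_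
  · rintro ⟨k, j⟩ h; simp at h ⊢; omega
  · rintro ⟨k, j⟩ h; simp at h ⊢; omega
  · rintro ⟨k, j⟩ h; simp at h ⊢; omega
  · rintro ⟨k, j⟩ h; simp
  · rintro ⟨k, j⟩ h
    simp at h ⊢
    rw [Nat.add_sub_cancel' (by omega)]

/-- The factor `(-1)^j p^(-j(j+1)/2)` relating `(p⁻ⁿ; p)_j` to `(p; p)_n / (p; p)_{n-j}`. -/
def reversalSign (p : F) (j : ℕ) : F := ∏ l ∈ range j, -(p ^ (l + 1))⁻¹

/-- The value of `(p^(-(j+i)); p)_j` in terms of `(p; p)_{j+i} / (p; p)_i`. -/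
theorem qPochhammer_inv_pow {p : F} (hp : p ≠ 0) (j i : ℕ) :
    qPochhammer (p ^ (j + i))⁻¹ p j * (p ^ j) ^ i * qPochhammer p p i =
      reversalSign p j * qPochhammer p p (j + i) := by
  rw [add_comm j i, qPochhammer_add p p i j]
  have h : qPochhammer (p ^ (i + j))⁻¹ p j * (p ^ j) ^ i =
      reversalSign p j * qPochhammer (p * p ^ i) p j := by
    have e : (p ^ j) ^ i = ∏ _l ∈ range j, p ^ i := by
      rw [prod_const, card_range, ← pow_mul, ← pow_mul, mul_comm]
    rw [e, qPochhammer, ← prod_range_reflect, reversalSign, qPochhammer, ← prod_mul_distrib,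
      ← prod_mul_distrib]
    refine prod_congr rfl fun l hl => ?_
    obtain ⟨t, rfl⟩ : ∃ t, j = l + 1 + t := ⟨j - 1 - l, by have := mem_range.1 hl; omega⟩
    rw [show l + 1 + t - 1 - l = t by omega]
    have := pow_ne_zero (l + 1) hp
    have := pow_ne_zero t hp
    have := pow_ne_zero i hp
    have := hp
    rw [pow_add, pow_add]
    field_simp
    ring
  rw [h]
  ring

/-- The parameters `b` and `c` are expanded by the `q`-Pfaff–Saalschütz sum; what remains is the
summand of a `₆φ₅`. -/
theorem vwpTerm_eq_sixPhiFiveTerm_mul_sum {p α b c d e f : F} (hp : p ≠ 0)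
    (hp1 : ∀ i, p * p ^ i ≠ 1) (hα : α ≠ 0) (hb0 : b ≠ 0) (hc0 : c ≠ 0)
    (hb : ∀ i, α * p / b * p ^ i ≠ 1) (hc : ∀ i, α * p / c * p ^ i ≠ 1) (k : ℕ) :
    vwpTerm p α b c d e f k =
      sixPhiFiveTerm p α d e f (α * p / f) (α * p / (d * e * f)) k *
        ∑ j ∈ range (k + 1), threePhiTwoTerm p (p ^ k)⁻¹ (α * p ^ k) (α * p / (b * c))
          (α * p / b) (α * p / c) j := by
  have e1 : α * p / b * (α * p / c) / (p * (α * p / (b * c))) = α := by field_simp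
  have e2 : α * p / c / (α * p / (b * c)) = b := by field_simp
  have e3 : α * p / b / (α * p / (b * c)) = c := by field_simp
  have e4 : α * p / α = p := by field_simp
  have h := sum_threePhiTwoTerm hp hp1 k (x := α * p / (b * c)) (by positivity) hb hc
  rw [e1, e2, e3] at h
  rw [h, vwpTerm, sixPhiFiveTerm, wellPoised, wellPoised, wellPoised, wellPoised, wellPoised,
    wellPoised, e4, show α ^ 2 * p ^ 2 / (b * c * d * e * f) =
      α * p / (d * e * f) * (α * p / (b * c)) by ring, mul_pow]
  ring

/-- After interchanging the sums, the inner sum over `k = j + i` is again a `₆φ₅`, with `(α, d, e)`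
replaced by `(α p^(2j), d p^j, e p^j)`. -/
theorem sixPhiFiveTerm_mul_threePhiTwoTerm {p α d e : F} (hp : p ≠ 0)
    (hp1 : ∀ i, p * p ^ i ≠ 1) (x B C y z : F) (j i M : ℕ) :
    sixPhiFiveTerm p α d e (p ^ (j + M))⁻¹ y z (j + i) *
        threePhiTwoTerm p (p ^ (j + i))⁻¹ (α * p ^ (j + i)) x B C j =
      qPochhammer α p (2 * j) * qPochhammer d p j * qPochhammer e p j *
        qPochhammer (p ^ (j + M))⁻¹ p j / (qPochhammer (α * p / d) p j *
          qPochhammer (α * p / e) p j * qPochhammer y p j) * z ^ j *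
        (qPochhammer x p j * p ^ j / (qPochhammer p p j * qPochhammer B p j *
          qPochhammer C p j)) * reversalSign p j *
      sixPhiFiveTerm p (α * p ^ (2 * j)) (d * p ^ j) (e * p ^ j) (p ^ M)⁻¹ (y * p ^ j)
        (z / p ^ j) i := by
  have hpj : p ^ j ≠ 0 := pow_ne_zero j hp
  have hpM : p ^ M ≠ 0 := pow_ne_zero M hp
  have ed : α * p ^ (2 * j) * p / (d * p ^ j) = α * p / d * p ^ j := by
    rw [two_mul, pow_add]; field_simp
  have ee : α * p ^ (2 * j) * p / (e * p ^ j) = α * p / e * p ^ j := by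
    rw [two_mul, pow_add]; field_simp
  have ef : (p ^ (j + M))⁻¹ * p ^ j = (p ^ M)⁻¹ := by rw [pow_add]; field_simp
  have eα : qPochhammer α p (j + i) * qPochhammer (α * p ^ (j + i)) p j =
      qPochhammer α p (2 * j) * qPochhammer (α * p ^ (2 * j)) p i := by
    rw [← qPochhammer_add, ← qPochhammer_add]; congr 1; ring
  have es := qPochhammer_inv_pow hp j i
  have h1 := qPochhammer_ne_zero hp1 (j + i)
  have h2 := qPochhammer_ne_zero hp1 i
  have es' : qPochhammer (p ^ (j + i))⁻¹ p j / qPochhammer p p (j + i) =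
      reversalSign p j / ((p ^ j) ^ i * qPochhammer p p i) := by
    rw [div_eq_div_iff h1 (mul_ne_zero (pow_ne_zero _ hpj) h2)]
    linear_combination es
  simp only [sixPhiFiveTerm, threePhiTwoTerm]
  rw [ed, ee, show α * p ^ (2 * j) * p ^ (2 * i) = α * p ^ (2 * (j + i)) by ring,
    qPochhammer_add d, qPochhammer_add e, qPochhammer_add (p ^ (j + M))⁻¹, ef,
    qPochhammer_add (α * p / d), qPochhammer_add (α * p / e), qPochhammer_add y, div_pow, pow_add z]
  generalize qPochhammer (α * p / d) p j = u1
  generalize qPochhammer (α * p / e) p j = u2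
  generalize qPochhammer (α * p / d * p ^ j) p i = u3
  generalize qPochhammer (α * p / e * p ^ j) p i = u4
  generalize (1 - α * p ^ (2 * (j + i))) = G
  generalize qPochhammer d p j = u5
  generalize qPochhammer e p j = u6
  generalize qPochhammer (d * p ^ j) p i = u7
  generalize qPochhammer (e * p ^ j) p i = u8
  generalize qPochhammer (p ^ M)⁻¹ p i = u9
  generalize qPochhammer (p ^ (j + M))⁻¹ p j = u10
  generalize qPochhammer (y * p ^ j) p i = u11
  trans G * (qPochhammer α p (j + i) * qPochhammer (α * p ^ (j + i)) p j) *
    (qPochhammer (p ^ (j + i))⁻¹ p j / qPochhammer p p (j + i)) * (u5 * u7 * (u6 * u8) *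
      (u10 * u9) / (u1 * u3 * (u2 * u4) * (qPochhammer y p j * u11)) * (z ^ j * z ^ i) *
      (qPochhammer x p j / (qPochhammer p p j * qPochhammer B p j * qPochhammer C p j) * p ^ j))
  · ring
  · rw [eα, es']
    ring

/-- Watson's transformation of a terminating very-well-poised `₈φ₇`, in a form in which the
`₄φ₃` on the right has no denominators involving the terminating parameter. -/
theorem sum_vwpTerm_eq {p α b c d e : F} (hp : p ≠ 0) (hp1 : ∀ i, p * p ^ i ≠ 1) (hα0 : α ≠ 0)
    (hα : ∀ i, α * p * p ^ i ≠ 1) (hb0 : b ≠ 0) (hc0 : c ≠ 0) (hd0 : d ≠ 0) (he0 : e ≠ 0)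
    (hb : ∀ i, α * p / b * p ^ i ≠ 1) (hc : ∀ i, α * p / c * p ^ i ≠ 1)
    (hd : ∀ i, α * p / d * p ^ i ≠ 1) (he : ∀ i, α * p / e * p ^ i ≠ 1) (N : ℕ) :
    ∑ k ∈ range (N + 1), vwpTerm p α b c d e (p ^ N)⁻¹ k =
      ∑ j ∈ range (N + 1), qPochhammer α p (N + 1) *
        (qPochhammer (α * p / (b * c)) p j * qPochhammer (α * p / (d * e)) p (N - j)) *
        (qPochhammer d p j * qPochhammer e p j * qPochhammer (p ^ N)⁻¹ p j /
          (qPochhammer p p j * qPochhammer (α * p / b) p j * qPochhammer (α * p / c) p j *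
            qPochhammer (α * p / d) p N * qPochhammer (α * p / e) p N)) *
        (reversalSign p j * p ^ j * (α * p * p ^ N / (d * e)) ^ j) := by
  rw [sum_congr rfl fun k _ =>
    vwpTerm_eq_sixPhiFiveTerm_mul_sum (d := d) (e := e) (f := (p ^ N)⁻¹) hp hp1 hα0 hb0 hc0 hb hc k]
  simp only [mul_sum]
  rw [sum_range_sum_range_succ]
  refine sum_congr rfl fun j hj => ?_
  obtain ⟨M, rfl⟩ : ∃ M, N = j + M := ⟨N - j, by have := mem_range.1 hj; omega⟩
  have hpj : p ^ j ≠ 0 := pow_ne_zero j hp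
  have hpM : p ^ M ≠ 0 := pow_ne_zero M hp
  have hjM : p ^ (j + M) ≠ 0 := pow_ne_zero _ hp
  have shift : ∀ {x : F}, (∀ i, x * p ^ i ≠ 1) → ∀ i, x * p ^ j * p ^ i ≠ 1 := fun h i => by
    rw [mul_assoc, ← pow_add]; exact h _
  have ed : α * p ^ (2 * j) * p / (d * p ^ j) = α * p / d * p ^ j := by
    rw [two_mul, pow_add]; field_simp
  have ee : α * p ^ (2 * j) * p / (e * p ^ j) = α * p / e * p ^ j := by
    rw [two_mul, pow_add]; field_simp
  have ede : α * p ^ (2 * j) * p / (d * p ^ j * (e * p ^ j)) = α * p / (d * e) := by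
    rw [two_mul, pow_add]; field_simp
  have h := sum_sixPhiFiveTerm hp hp1 M (α := α * p ^ (2 * j)) (mul_ne_zero hd0 hpj)
    (mul_ne_zero he0 hpj) (by rw [ed]; exact shift hd) (by rw [ee]; exact shift he)
    (by
      intro i
      rw [show α * p ^ (2 * j) * p * p ^ i = α * p * p ^ (2 * j + i) by ring]
      exact hα _)
  rw [Nat.add_sub_cancel_left, sum_congr rfl fun i _ =>
    sixPhiFiveTerm_mul_threePhiTwoTerm hp hp1 _ _ _ _ _ j i M, ← mul_sum]
  have ey : α * p / (p ^ (j + M))⁻¹ = α * p * p ^ (j + M) := by rw [div_inv_eq_mul]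
  have ez : α * p / (d * e * (p ^ (j + M))⁻¹) = α * p * p ^ (j + M) / (d * e) := by
    field_simp
  have e1 : α * p * p ^ (j + M) * p ^ j = α * p ^ (2 * j) * p * p ^ M := by ring
  have e2 : α * p * p ^ (j + M) / (d * e) / p ^ j =
      α * p ^ (2 * j) * p * p ^ M / (d * p ^ j * (e * p ^ j)) := by
    rw [two_mul, pow_add, pow_add]; field_simp
  rw [ey, ez, e1, e2, h, ed, ee, ede]
  have hy : qPochhammer (α * p * p ^ (j + M)) p j ≠ 0 := qPochhammer_ne_zero (fun i => by
    rw [mul_assoc _ (p ^ (j + M)), ← pow_add]; exact hα _) _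
  have eα : qPochhammer α p (2 * j) * qPochhammer (α * p ^ (2 * j)) p (M + 1) =
      qPochhammer α p (j + M + 1) * qPochhammer (α * p * p ^ (j + M)) p j := by
    rw [← qPochhammer_add, show α * p * p ^ (j + M) = α * p ^ (j + M + 1) by ring,
      ← qPochhammer_add]
    congr 1; ring
  have eα' : qPochhammer α p (2 * j) * qPochhammer (α * p ^ (2 * j)) p (M + 1) /
      qPochhammer (α * p * p ^ (j + M)) p j = qPochhammer α p (j + M + 1) := by
    rw [div_eq_iff hy, eα]
  rw [← eα', qPochhammer_add (α * p / d), qPochhammer_add (α * p / e)]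
  generalize qPochhammer (α * p * p ^ (j + M)) p j = u0
  generalize qPochhammer (α * p / d) p j = u1
  generalize qPochhammer (α * p / e) p j = u2
  generalize qPochhammer (α * p / d * p ^ j) p M = u3
  generalize qPochhammer (α * p / e * p ^ j) p M = u4
  generalize qPochhammer (α * p / b) p j = u5
  generalize qPochhammer (α * p / c) p j = u6
  generalize (α * p * p ^ (j + M) / (d * e)) = zz
  ring

end WatsonTransformation

/-! ### Antisymmetry of terminating very-well-poised series -/

section Reversal

variable {F : Type*} [Field F]

/-- For `α = p⁻⁽ᵏ⁺ˡ⁾` the contribution of a parameter to the `k`-th term is, up to an elementary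
factor, symmetric in `k` and `l`. -/
theorem wellPoised_inv_pow {p x : F} (hp : p ≠ 0) (hx0 : x ≠ 0) (k l : ℕ)
    (hx : ∀ i < k + l, x * p ^ i ≠ 1) :
    wellPoised (p ^ (k + l))⁻¹ p x k =
      (-x) ^ k * (∏ i ∈ range k, p ^ (l + i)) *
        (qPochhammer x p k * qPochhammer x p l / qPochhammer x p (k + l)) := by
  have hG : qPochhammer x p (k + l) ≠ 0 :=
    prod_ne_zero_iff.2 fun i hi => sub_ne_zero.2 (hx i (mem_range.1 hi)).symm
  have h : qPochhammer ((p ^ (k + l))⁻¹ * p / x) p k *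
      ((-x) ^ k * ∏ i ∈ range k, p ^ (l + i)) = qPochhammer (x * p ^ l) p k := by
    rw [← card_range k, ← prod_const, card_range, ← prod_range_reflect (fun i => p ^ (l + i)),
      ← prod_range_reflect (fun i => -x), qPochhammer, qPochhammer,
      ← prod_range_reflect (fun i => 1 - x * p ^ l * p ^ i), ← prod_mul_distrib,
      ← prod_mul_distrib]
    refine prod_congr rfl fun i hi => ?_
    obtain ⟨t, rfl⟩ : ∃ t, k = i + 1 + t := ⟨k - 1 - i, by have := mem_range.1 hi; omega⟩
    rw [show i + 1 + t - 1 - i = t by omega]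
    have := pow_ne_zero i hp
    have := pow_ne_zero t hp
    have := pow_ne_zero l hp
    rw [pow_add, pow_add, pow_add, pow_add]
    field_simp
    ring
  rw [add_comm k l, qPochhammer_add x p l k] at hG
  have hG2 := right_ne_zero_of_mul hG
  have hG1 := left_ne_zero_of_mul hG
  have hD : qPochhammer ((p ^ (k + l))⁻¹ * p / x) p k ≠ 0 := by
    intro h0
    rw [h0, zero_mul] at h
    exact hG2 h.symm
  rw [wellPoised, div_eq_iff hD]
  trans qPochhammer x p k * qPochhammer x p l / qPochhammer x p (k + l) *
    (qPochhammer ((p ^ (k + l))⁻¹ * p / x) p k * ((-x) ^ k * ∏ i ∈ range k, p ^ (l + i)))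
  · rw [h, add_comm k l, qPochhammer_add x p l k]
    field_simp
  · ring

/-- The exponent `l + (l + 1) + ⋯ + (l + k - 1)`, doubled to avoid division. -/
theorem prod_pow_add_sq (p : F) (k l : ℕ) :
    (∏ i ∈ range k, p ^ (l + i)) ^ 2 * p ^ k = p ^ (k * (2 * l + k)) := by
  induction k with
  | zero => simp
  | succ k ih =>
    rw [prod_range_succ, mul_pow, pow_succ p k]
    calc _ = ((∏ i ∈ range k, p ^ (l + i)) ^ 2 * p ^ k) * ((p ^ (l + k)) ^ 2 * p) := by ring
      _ = _ := by rw [ih]; ring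

/-- A very-well-poised term with leading parameter `p⁻ʳ`, `r = k + l`, changes sign when `k` and `l`
are interchanged; the five remaining parameters are arbitrary. -/
theorem vwpTerm_reflect {p b c d e f : F} (hp : p ≠ 0) (hp1 : ∀ i, p * p ^ i ≠ 1)
    (hb0 : b ≠ 0) (hc0 : c ≠ 0) (hd0 : d ≠ 0) (he0 : e ≠ 0) (hf0 : f ≠ 0) (k l : ℕ)
    (hb : ∀ i < k + l, b * p ^ i ≠ 1) (hc : ∀ i < k + l, c * p ^ i ≠ 1)
    (hd : ∀ i < k + l, d * p ^ i ≠ 1) (he : ∀ i < k + l, e * p ^ i ≠ 1)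
    (hf : ∀ i < k + l, f * p ^ i ≠ 1) :
    vwpTerm p (p ^ (k + l))⁻¹ b c d e f k = -vwpTerm p (p ^ (k + l))⁻¹ b c d e f l := by
  have hα0 : (p ^ (k + l))⁻¹ ≠ 0 := inv_ne_zero (pow_ne_zero _ hp)
  have hα : ∀ i < k + l, (p ^ (k + l))⁻¹ * p ^ i ≠ 1 := by
    intro i hi h
    obtain ⟨t, ht⟩ : ∃ t, k + l = i + 1 + t := ⟨k + l - 1 - i, by omega⟩
    rw [inv_mul_eq_one₀ (pow_ne_zero _ hp), ht, add_assoc, pow_add] at h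
    apply hp1 t
    have : p ^ i * (p * p ^ t) = p ^ i * 1 := by rw [mul_one, ← pow_succ', add_comm t, h]
    exact mul_left_cancel₀ (pow_ne_zero i hp) this
  have main : ∀ k' l' : ℕ, k' + l' = k + l → ∀ g : F → F,
      (∀ x, g x = qPochhammer x p k' * qPochhammer x p l' / qPochhammer x p (k + l)) →
      vwpTerm p (p ^ (k + l))⁻¹ b c d e f k' =
        p ^ (3 * (k' * l')) * ((p ^ k')⁻¹ - (p ^ l')⁻¹) *
          (g (p ^ (k + l))⁻¹ * g b * g c * g d * g e * g f) := by
    intro k' l' hkl g hg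
    rw [vwpTerm]
    simp only [← hkl] at *
    rw [wellPoised_inv_pow hp hα0 k' l' hα, wellPoised_inv_pow hp hb0 k' l' hb,
      wellPoised_inv_pow hp hc0 k' l' hc, wellPoised_inv_pow hp hd0 k' l' hd,
      wellPoised_inv_pow hp he0 k' l' he, wellPoised_inv_pow hp hf0 k' l' hf,
      ← hg, ← hg, ← hg, ← hg, ← hg, ← hg]
    have hσ := prod_pow_add_sq p k' l'
    generalize ∏ i ∈ range k', p ^ (l' + i) = σ at *
    have hk := pow_ne_zero k' hp
    have hl := pow_ne_zero l' hp
    have e1 : ((p ^ (k' + l'))⁻¹ * b * c * d * e * f) ^ k' *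
        ((p ^ (k' + l'))⁻¹ ^ 2 * p ^ 2 / (b * c * d * e * f)) ^ k' =
          p ^ (2 * k') / p ^ (3 * k' * (k' + l')) := by
      have : p ^ (2 * k') / p ^ (3 * k' * (k' + l')) = (p ^ 2 / (p ^ (k' + l')) ^ 3) ^ k' := by
        rw [div_pow]; ring
      rw [← mul_pow, this]
      congr 1
      field_simp
    have e2 : σ ^ 6 * (p ^ (2 * k') / p ^ (3 * k' * (k' + l'))) = p ^ (3 * (k' * l')) / p ^ k' := by
      rw [mul_div_assoc', div_eq_div_iff (pow_ne_zero _ hp) (pow_ne_zero _ hp)]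
      calc σ ^ 6 * p ^ (2 * k') * p ^ k' = (σ ^ 2 * p ^ k') ^ 3 := by ring
        _ = _ := by rw [hσ]; ring
    have e3 : (1 - (p ^ (k' + l'))⁻¹ * p ^ (2 * k')) / p ^ k' = (p ^ k')⁻¹ - (p ^ l')⁻¹ := by
      rw [pow_add, two_mul, pow_add]; field_simp
    have e4 : ((-1 : F) ^ k') ^ 6 = 1 := by rw [pow_right_comm]; norm_num
    rw [neg_pow (p ^ (k' + l'))⁻¹, neg_pow b, neg_pow c, neg_pow d, neg_pow e, neg_pow f]
    trans (1 - (p ^ (k' + l'))⁻¹ * p ^ (2 * k')) * ((-1 : F) ^ k') ^ 6 *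
      (σ ^ 6 * (((p ^ (k' + l'))⁻¹ * b * c * d * e * f) ^ k' *
        ((p ^ (k' + l'))⁻¹ ^ 2 * p ^ 2 / (b * c * d * e * f)) ^ k')) *
      (g (p ^ (k' + l'))⁻¹ * g b * g c * g d * g e * g f)
    · simp only [mul_pow]
      ring
    · rw [e1, e2, e4, ← e3]
      ring
  rw [main k l rfl (fun x => _) fun x => rfl,
    main l k (add_comm _ _) (fun x => _) fun x => by rw [mul_comm (qPochhammer x p l)]]
  ring

theorem sum_vwpTerm_reflect {p b c d e f : F} [CharZero F] (hp : p ≠ 0) (hp1 : ∀ i, p * p ^ i ≠ 1)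
    (hb0 : b ≠ 0) (hc0 : c ≠ 0) (hd0 : d ≠ 0) (he0 : e ≠ 0) (hf0 : f ≠ 0) (r : ℕ)
    (hb : ∀ i < r, b * p ^ i ≠ 1) (hc : ∀ i < r, c * p ^ i ≠ 1)
    (hd : ∀ i < r, d * p ^ i ≠ 1) (he : ∀ i < r, e * p ^ i ≠ 1)
    (hf : ∀ i < r, f * p ^ i ≠ 1) :
    ∑ k ∈ range (r + 1), vwpTerm p (p ^ r)⁻¹ b c d e f k = 0 := by
  rw [← self_eq_neg, ← sum_neg_distrib, ← sum_range_reflect]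
  refine sum_congr rfl fun k hk => ?_
  obtain ⟨l, rfl⟩ : ∃ l, r = k + l := ⟨r - k, by have := mem_range.1 hk; omega⟩
  rw [vwpTerm_reflect hp hp1 hb0 hc0 hd0 he0 hf0 k l hb hc hd he hf, neg_neg]
  congr 1
  omega

end Reversal

/-! ### Divisibility in a localization -/

section LocalDivisibility

variable {R L : Type*} [CommRing R] [Field L] [Algebra R L] {P : R}

/-- `x` lies in `P^j` times the localization of `R` at the elements coprime to `P`. -/
def LocDvd (P : R) (j : ℕ) (x : L) : Prop :=
  ∃ f g : R, IsCoprime g P ∧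
    algebraMap R L g * x = algebraMap R L (P ^ j * f)

/-- `x` is a unit of the localization of `R` at the elements coprime to `P`. -/
structure LocUnit (P : R) (x : L) : Prop where
  locDvd : LocDvd P 0 x
  locDvd_inv : LocDvd P 0 x⁻¹
  ne_zero : x ≠ 0

/-- Congruence modulo `P` in the localization of `R` at the elements coprime to `P`. -/
structure LocCongr (P : R) (x y : L) : Prop where
  left : LocDvd P 0 x
  right : LocDvd P 0 y
  sub : LocDvd P 1 (x - y)

theorem locDvd_algebraMap (f : R) : LocDvd P 0 (algebraMap R L f) :=
  ⟨f, 1, isCoprime_one_left, by simp⟩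

theorem locDvd_zero (j : ℕ) : LocDvd P j (0 : L) := ⟨0, 1, isCoprime_one_left, by simp⟩

theorem locDvd_one : LocDvd P 0 (1 : L) := by
  simpa using locDvd_algebraMap (L := L) (P := P) 1

theorem LocDvd.mono {i j : ℕ} {x : L} (h : LocDvd P j x) (hij : i ≤ j) : LocDvd P i x := by
  obtain ⟨f, g, hg, e⟩ := h
  refine ⟨P ^ (j - i) * f, g, hg, ?_⟩
  rw [e, ← mul_assoc, ← pow_add, Nat.add_sub_cancel' hij]

theorem LocDvd.mul {i j : ℕ} {x y : L} (hx : LocDvd P i x) (hy : LocDvd P j y) :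
    LocDvd P (i + j) (x * y) := by
  obtain ⟨f, g, hg, e⟩ := hx
  obtain ⟨f', g', hg', e'⟩ := hy
  refine ⟨f * f', g * g', hg.mul_left hg', ?_⟩
  rw [map_mul, mul_mul_mul_comm, e, e', ← map_mul]
  congr 1; ring

theorem LocDvd.mul_right {j : ℕ} {x y : L} (hx : LocDvd P j x) (hy : LocDvd P 0 y) :
    LocDvd P j (x * y) := hx.mul hy

theorem LocDvd.mul_left {j : ℕ} {x y : L} (hx : LocDvd P 0 x) (hy : LocDvd P j y) :
    LocDvd P j (x * y) := by simpa using hx.mul hy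

theorem LocDvd.add {j : ℕ} {x y : L} (hx : LocDvd P j x) (hy : LocDvd P j y) :
    LocDvd P j (x + y) := by
  obtain ⟨f, g, hg, e⟩ := hx
  obtain ⟨f', g', hg', e'⟩ := hy
  refine ⟨g' * f + g * f', g * g', hg.mul_left hg', ?_⟩
  simp only [map_mul, map_add] at *
  linear_combination algebraMap R L g' * e + algebraMap R L g * e'

theorem LocDvd.neg {j : ℕ} {x : L} (hx : LocDvd P j x) : LocDvd P j (-x) := by
  obtain ⟨f, g, hg, e⟩ := hx
  exact ⟨-f, g, hg, by rw [mul_neg, e, mul_neg, map_neg]⟩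

theorem LocDvd.sub {j : ℕ} {x y : L} (hx : LocDvd P j x) (hy : LocDvd P j y) :
    LocDvd P j (x - y) := by
  rw [sub_eq_add_neg]; exact hx.add hy.neg

theorem LocDvd.sum {ι : Type*} {s : Finset ι} {j : ℕ} {f : ι → L}
    (h : ∀ i ∈ s, LocDvd P j (f i)) : LocDvd P j (∑ i ∈ s, f i) :=
  sum_induction f (LocDvd P j) (fun _ _ => LocDvd.add) (locDvd_zero j) h

theorem LocDvd.prod {ι : Type*} {s : Finset ι} {f : ι → L}
    (h : ∀ i ∈ s, LocDvd P 0 (f i)) : LocDvd P 0 (∏ i ∈ s, f i) :=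
  prod_induction f (LocDvd P 0) (fun _ _ hx hy => hx.mul_right hy) locDvd_one h

theorem LocUnit.mul {x y : L} (hx : LocUnit P x) (hy : LocUnit P y) :
    LocUnit P (x * y) :=
  ⟨hx.1.mul_right hy.1, by rw [mul_inv]; exact hx.2.mul_right hy.2, mul_ne_zero hx.3 hy.3⟩

theorem LocUnit.inv {x : L} (hx : LocUnit P x) : LocUnit P x⁻¹ :=
  ⟨hx.2, by rw [inv_inv]; exact hx.1, inv_ne_zero hx.3⟩

theorem LocUnit.div {x y : L} (hx : LocUnit P x) (hy : LocUnit P y) :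
    LocUnit P (x / y) := by
  rw [div_eq_mul_inv]; exact hx.mul hy.inv

theorem locUnit_one : LocUnit P (1 : L) := ⟨locDvd_one, by simpa using locDvd_one, one_ne_zero⟩

theorem LocUnit.prod {ι : Type*} {s : Finset ι} {f : ι → L}
    (h : ∀ i ∈ s, LocUnit P (f i)) : LocUnit P (∏ i ∈ s, f i) :=
  prod_induction f (LocUnit P) (fun _ _ hx hy => hx.mul hy) locUnit_one h

theorem LocUnit.pow {x : L} (hx : LocUnit P x) (k : ℕ) : LocUnit P (x ^ k) := by
  simpa using LocUnit.prod (s := range k) (f := fun _ => x) fun _ _ => hx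

theorem LocUnit.zpow {x : L} (hx : LocUnit P x) (k : ℤ) : LocUnit P (x ^ k) := by
  cases k with
  | ofNat k => simpa using hx.pow k
  | negSucc k => rw [zpow_negSucc]; exact (hx.pow _).inv

theorem locUnit_algebraMap [FaithfulSMul R L] {g : R} (hg : IsCoprime g P) (h0 : g ≠ 0) :
    LocUnit P (algebraMap R L g) := by
  have h0' : algebraMap R L g ≠ 0 :=
    (map_ne_zero_iff _ (FaithfulSMul.algebraMap_injective R L)).2 h0
  exact ⟨locDvd_algebraMap g, ⟨1, g, hg, by simp [h0']⟩, h0'⟩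

theorem LocCongr.rfl {x : L} (hx : LocDvd P 0 x) : LocCongr P x x :=
  ⟨hx, hx, by rw [sub_self]; exact locDvd_zero 1⟩

theorem LocCongr.mul {x y x' y' : L} (h : LocCongr P x y) (h' : LocCongr P x' y') :
    LocCongr P (x * x') (y * y') :=
  ⟨h.left.mul_right h'.left, h.right.mul_right h'.right, by
    rw [show x * x' - y * y' = (x - y) * x' + y * (x' - y') by ring]
    exact (h.sub.mul_right h'.left).add (h.right.mul_left h'.sub)⟩

theorem LocCongr.sub' {x y x' y' : L} (h : LocCongr P x y) (h' : LocCongr P x' y') :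
    LocCongr P (x - x') (y - y') :=
  ⟨h.left.sub h'.left, h.right.sub h'.right, by
    rw [show x - x' - (y - y') = x - y - (x' - y') by ring]
    exact h.sub.sub h'.sub⟩

theorem LocCongr.inv {x y : L} (h : LocCongr P x y) (hx : LocUnit P x) (hy : LocUnit P y) :
    LocCongr P x⁻¹ y⁻¹ :=
  ⟨hx.2, hy.2, by
    have hx0 := hx.3
    have hy0 := hy.3
    rw [show x⁻¹ - y⁻¹ = -((x - y) * (x⁻¹ * y⁻¹)) by field_simp; ring]
    exact (h.sub.mul_right (hx.2.mul_right hy.2)).neg⟩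

theorem LocCongr.prod {ι : Type*} {s : Finset ι} {f g : ι → L}
    (h : ∀ i ∈ s, LocCongr P (f i) (g i)) : LocCongr P (∏ i ∈ s, f i) (∏ i ∈ s, g i) := by
  classical
  induction s using Finset.induction_on with
  | empty => simpa using LocCongr.rfl locDvd_one
  | insert a s ha ih =>
    rw [prod_insert ha, prod_insert ha]
    exact (h a (mem_insert_self _ _)).mul (ih fun i hi => h i (mem_insert_of_mem hi))

/-- A quantity depending on two binary choices, each of which alters it by a multiple of `P`, such
that the mixed second difference is a multiple of `P^2`.  These form a ring, closed under inverses
of units; it plays the role of functions of two parameters known to second order. -/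
structure LocBiCongr (P : R) (f : Bool → Bool → L) : Prop where
  congr : ∀ s t s' t', LocCongr P (f s t) (f s' t')
  mixed : LocDvd P 2 (f true true - f true false - f false true + f false false)

theorem LocBiCongr.const {x : L} (hx : LocDvd P 0 x) : LocBiCongr P fun _ _ => x :=
  ⟨fun _ _ _ _ => .rfl hx, by simpa using locDvd_zero 2⟩

theorem LocBiCongr.fst {f : Bool → L} (h : ∀ s s', LocCongr P (f s) (f s')) :
    LocBiCongr P fun s _ => f s :=
  ⟨fun _ _ _ _ => h _ _, by simpa using locDvd_zero 2⟩

theorem LocBiCongr.snd {f : Bool → L} (h : ∀ s s', LocCongr P (f s) (f s')) :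
    LocBiCongr P fun _ t => f t :=
  ⟨fun _ _ _ _ => h _ _, by simpa using locDvd_zero 2⟩

theorem LocBiCongr.sub {f g : Bool → Bool → L} (hf : LocBiCongr P f)
    (hg : LocBiCongr P g) : LocBiCongr P fun s t => f s t - g s t :=
  ⟨fun _ _ _ _ => (hf.congr _ _ _ _).sub' (hg.congr _ _ _ _), by
    convert hf.mixed.sub hg.mixed using 1; ring⟩

theorem LocBiCongr.mul {f g : Bool → Bool → L} (hf : LocBiCongr P f)
    (hg : LocBiCongr P g) : LocBiCongr P fun s t => f s t * g s t := by
  refine ⟨fun _ _ _ _ => (hf.congr _ _ _ _).mul (hg.congr _ _ _ _), ?_⟩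
  have h1 := hf.mixed.mul_right (hg.congr true true true true).left
  have h2 := (hf.congr false false true true).left.mul_left hg.mixed
  have h3 := (hf.congr true false false false).sub.mul (hg.congr true true true false).sub
  have h4 := (hf.congr false true false false).sub.mul (hg.congr true true false true).sub
  convert ((h1.add h2).add h3).add h4 using 1
  ring

theorem LocBiCongr.inv {f : Bool → Bool → L} (hf : LocBiCongr P f)
    (hu : ∀ s t, LocUnit P (f s t)) : LocBiCongr P fun s t => (f s t)⁻¹ := by
  have hc : ∀ s t s' t', LocCongr P (f s t)⁻¹ (f s' t')⁻¹ := fun s t s' t' =>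
    (hf.congr s t s' t').inv (hu s t) (hu s' t')
  refine ⟨hc, ?_⟩
  have h1 := hf.mixed.mul_right (((hu true true).inv.mul (hu true false).inv)).1
  have h2 := (hf.congr false true false false).sub.mul
    ((hc true true false true).mul (hc true false false false)).sub
  have e1 := (hu true true).3
  have e2 := (hu true false).3
  have e3 := (hu false true).3
  have e4 := (hu false false).3
  convert (h1.add h2).neg using 1
  field_simp
  ring

theorem LocBiCongr.prod {ι : Type*} {s : Finset ι} {f : ι → Bool → Bool → L}
    (h : ∀ i ∈ s, LocBiCongr P (f i)) : LocBiCongr P fun a b => ∏ i ∈ s, f i a b := by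
  classical
  induction s using Finset.induction_on with
  | empty => simpa using LocBiCongr.const locDvd_one
  | insert a s ha ih =>
    simp only [prod_insert ha]
    exact (h a (mem_insert_self _ _)).mul (ih fun i hi => h i (mem_insert_of_mem hi))

theorem LocBiCongr.pow {f : Bool → Bool → L} (h : LocBiCongr P f) (k : ℕ) :
    LocBiCongr P fun s t => f s t ^ k := by
  simpa using LocBiCongr.prod (s := range k) (f := fun _ => f) fun _ _ => h

end LocalDivisibility

/-! ### Factors `1 - c q^z` at a cyclotomic polynomial -/

section Cyclotomic

theorem LocDvd.dvd_num {K : Type*} [Field K] {P : K[X]} {j : ℕ} {x : RatFunc K}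
    (h : LocDvd P j x) : P ^ j ∣ x.num := by
  obtain ⟨f, g, hg, e⟩ := h
  have hinj := RatFunc.algebraMap_injective K
  have hd : algebraMap K[X] (RatFunc K) x.denom ≠ 0 :=
    (map_ne_zero_iff _ hinj).2 x.denom_ne_zero
  have h1 : g * x.num = P ^ j * (f * x.denom) := by
    apply hinj
    rw [← mul_assoc, map_mul, map_mul _ (P ^ j * f), ← e, mul_assoc]
    congr 1
    rw [← div_eq_iff hd, RatFunc.num_div_denom]
  exact (hg.pow_right.symm).dvd_of_dvd_mul_left (Dvd.intro _ h1.symm)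

variable {K : Type*} [Field K]

theorem isCoprime_X_cyclotomic {m : ℕ} (hm : 0 < m) : IsCoprime (X : K[X]) (cyclotomic m K) := by
  have : IsCoprime (X : K[X]) (X ^ m - 1) :=
    ⟨X ^ (m - 1), -1, by rw [← pow_succ, Nat.sub_add_cancel hm]; ring⟩
  exact this.of_isCoprime_of_dvd_right (cyclotomic.dvd_X_pow_sub_one m K)

/-- Modulo `Φ_m` one has `(c q^k)^m = c^m`, so `1 - c q^k` is invertible unless `c^m = 1`. -/
theorem isCoprime_one_sub_C_mul_X_pow {m : ℕ} {c : K} (hc : c ^ m ≠ 1) (k : ℕ) :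
    IsCoprime (1 - C c * X ^ k) (cyclotomic m K) := by
  obtain ⟨u, hu⟩ : (1 - C c * X ^ k : K[X]) ∣ 1 - (C c * X ^ k) ^ m := by
    simpa using sub_dvd_pow_sub_pow (1 : K[X]) (C c * X ^ k) m
  obtain ⟨v, hv⟩ : (X ^ m - 1 : K[X]) ∣ (X ^ m) ^ k - 1 := by
    simpa using sub_dvd_pow_sub_pow (X ^ m : K[X]) 1 k
  have hc' : 1 - c ^ m ≠ 0 := sub_ne_zero.2 hc.symm
  have e : C (1 - c ^ m)⁻¹ * (1 - C (c ^ m)) = (1 : K[X]) := by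
    rw [← C_1, ← C_sub, ← C_mul, inv_mul_cancel₀ hc']
  have : IsCoprime (1 - C c * X ^ k) (X ^ m - 1 : K[X]) := by
    refine ⟨C (1 - c ^ m)⁻¹ * u, C (1 - c ^ m)⁻¹ * C (c ^ m) * v, ?_⟩
    rw [C_pow] at *
    linear_combination e - C (1 - c ^ m)⁻¹ * hu - C (1 - c ^ m)⁻¹ * C c ^ m * hv
  exact this.of_isCoprime_of_dvd_right (cyclotomic.dvd_X_pow_sub_one m K)

/-- Over `ℚ` the polynomial `Φ_m` is irreducible and does not divide `1 - q^k` unless `m` divides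
`k`; coprimality is preserved by extending the field. -/
theorem isCoprime_one_sub_X_pow [CharZero K] {m k : ℕ} (hm : 0 < m) (hk : ¬ m ∣ k) :
    IsCoprime (1 - X ^ k) (cyclotomic m K) := by
  have h : IsCoprime (cyclotomic m ℚ) (1 - X ^ k) := by
    rw [(cyclotomic.irreducible_rat hm).coprime_iff_not_dvd]
    intro hdvd
    have hζ := Complex.isPrimitiveRoot_exp m hm.ne'
    have hroot : (cyclotomic m ℂ).IsRoot (Complex.exp (2 * Real.pi * Complex.I / m)) :=
      hζ.isRoot_cyclotomic hm
    have h2 := Polynomial.map_dvd (algebraMap ℚ ℂ) hdvd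
    rw [map_cyclotomic] at h2
    have h3 := hroot.dvd h2
    simp [sub_eq_zero] at h3
    exact hk ((hζ.pow_eq_one_iff_dvd k).1 h3.symm)
  have := h.symm.map (mapRingHom (algebraMap ℚ K))
  simpa using this

variable {L : Type*} [Field L] [Algebra K[X] L]

variable (K L) in
/-- The indeterminate `q`, as an element of an extension `L` of `K[q]`. -/
noncomputable def qElem : L := algebraMap K[X] L X

variable (L) in
/-- The constant `c`, as an element of an extension `L` of `K[q]`. -/
noncomputable def constElem (c : K) : L := algebraMap K[X] L (C c)

theorem constElem_mul (c c' : K) : constElem L (c * c') = constElem L c * constElem L c' := by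
  simp [constElem]

theorem constElem_one : constElem L (1 : K) = 1 := by simp [constElem]

theorem constElem_inv (c : K) : constElem L c⁻¹ = (constElem L c)⁻¹ := by
  by_cases hc : c = 0
  · simp [hc, constElem]
  · exact eq_inv_of_mul_eq_one_left (by rw [← constElem_mul, inv_mul_cancel₀ hc, constElem_one])

variable [FaithfulSMul K[X] L]

theorem constElem_ne_zero {c : K} (hc : c ≠ 0) : constElem L c ≠ 0 := by
  rw [constElem, map_ne_zero_iff _ (FaithfulSMul.algebraMap_injective K[X] L)]
  simpa using hc

theorem locUnit_qElem {m : ℕ} (hm : 0 < m) : LocUnit (cyclotomic m K) (qElem K L) :=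
  locUnit_algebraMap (isCoprime_X_cyclotomic hm) X_ne_zero

theorem qElem_ne_zero : qElem K L ≠ 0 := (locUnit_qElem one_pos).ne_zero

theorem locUnit_constElem {P : K[X]} {c : K} (hc : c ≠ 0) : LocUnit P (constElem L c) :=
  locUnit_algebraMap ⟨C c⁻¹, 0, by rw [zero_mul, add_zero, ← C_mul, inv_mul_cancel₀ hc, C_1]⟩
    (by simpa using hc)

theorem locDvd_one_sub_qElem_zpow {m : ℕ} (hm : 0 < m) {z : ℤ} (h : (m : ℤ) ∣ z) :
    LocDvd (cyclotomic m K) 1 (1 - qElem K L ^ z) := by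
  have nat : ∀ k : ℕ, m ∣ k → LocDvd (cyclotomic m K) 1 (1 - qElem K L ^ k) := by
    rintro _ ⟨k, rfl⟩
    have h1 : cyclotomic m K ∣ 1 - (X ^ m) ^ k := by
      refine (cyclotomic.dvd_X_pow_sub_one m K).trans ?_
      rw [← dvd_neg, neg_sub]
      simpa using sub_dvd_pow_sub_pow (X ^ m : K[X]) 1 k
    obtain ⟨f, hf⟩ := h1
    exact ⟨f, 1, isCoprime_one_left, by
      rw [map_one, one_mul, pow_one, ← hf]; simp [qElem, pow_mul]⟩
  obtain ⟨k, rfl | rfl⟩ := z.eq_nat_or_neg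
  · rw [zpow_natCast]
    exact nat k (Int.natCast_dvd_natCast.1 h)
  · have hq : qElem K L ≠ 0 := qElem_ne_zero
    have e : 1 - qElem K L ^ (-(k : ℤ)) = -(qElem K L ^ (-(k : ℤ)) * (1 - qElem K L ^ k)) := by
      rw [zpow_neg, zpow_natCast]; field_simp; ring
    rw [e]
    exact (((locUnit_qElem hm).zpow _).1.mul_left
      (nat k (Int.natCast_dvd_natCast.1 (dvd_neg.1 h)))).neg

variable [CharZero K]

theorem locUnit_one_sub_pow {m : ℕ} (hm : 0 < m) {c : K} {k : ℕ}
    (h : c ^ m ≠ 1 ∨ c = 1 ∧ ¬ m ∣ k) :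
    LocUnit (cyclotomic m K) (1 - constElem L c * qElem K L ^ k) := by
  have hco : IsCoprime (1 - C c * X ^ k) (cyclotomic m K) := by
    rcases h with h | ⟨rfl, h⟩
    · exact isCoprime_one_sub_C_mul_X_pow h k
    · simpa using isCoprime_one_sub_X_pow (K := K) hm h
  have := locUnit_algebraMap (L := L) hco (by
    intro h0
    rw [h0, isCoprime_zero_left] at hco
    exact (degree_cyclotomic_pos m K hm).ne' (degree_eq_zero_of_isUnit hco))
  simpa [constElem, qElem] using this

theorem locUnit_one_sub_zpow {m : ℕ} (hm : 0 < m) {c : K} (hc : c ≠ 0) {z : ℤ}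
    (h : c ^ m ≠ 1 ∨ c = 1 ∧ ¬ (m : ℤ) ∣ z) :
    LocUnit (cyclotomic m K) (1 - constElem L c * qElem K L ^ z) := by
  obtain ⟨k, rfl | rfl⟩ := z.eq_nat_or_neg
  · rw [zpow_natCast]
    exact locUnit_one_sub_pow hm (by simpa [Int.natCast_dvd_natCast] using h)
  · have h' : c⁻¹ ^ m ≠ 1 ∨ c⁻¹ = 1 ∧ ¬ m ∣ k := by
      simpa [Int.natCast_dvd_natCast] using h
    have hq : qElem K L ≠ 0 := qElem_ne_zero
    have hc0 : constElem L c ≠ 0 := constElem_ne_zero hc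
    have e : 1 - constElem L c * qElem K L ^ (-(k : ℤ)) =
        constElem L (-c) * qElem K L ^ (-(k : ℤ)) * (1 - constElem L c⁻¹ * qElem K L ^ k) := by
      have : constElem L (-c) = -constElem L c := by simp [constElem]
      rw [zpow_neg, zpow_natCast, constElem_inv, this]
      field_simp
      ring
    rw [e]
    exact ((locUnit_constElem (neg_ne_zero.2 hc)).mul ((locUnit_qElem hm).zpow _)).mul
      (locUnit_one_sub_pow hm h')

theorem locUnit_one_sub_qElem_zpow {m : ℕ} (hm : 0 < m) {z : ℤ} (h : ¬ (m : ℤ) ∣ z) :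
    LocUnit (cyclotomic m K) (1 - qElem K L ^ z) := by
  simpa [constElem_one] using
    locUnit_one_sub_zpow (L := L) (K := K) hm one_ne_zero (Or.inr ⟨rfl, h⟩)

theorem qElem_zpow_ne_one {z : ℤ} (hz : z ≠ 0) : qElem K L ^ z ≠ 1 := by
  -- `1 - q^z` is a unit at `Φ_m` for `m = |z| + 1`, in particular it is nonzero.
  have h : ¬ ((z.natAbs + 1 : ℕ) : ℤ) ∣ z := fun h => by
    have h1 := Int.le_of_dvd (Int.natAbs_pos.2 hz |> Int.ofNat_lt.2) (Int.dvd_natAbs.2 h)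
    push_cast at h1
    omega
  have hu := locUnit_one_sub_qElem_zpow (K := K) (L := L) (Nat.succ_pos _) h
  exact (sub_ne_zero.1 hu.ne_zero).symm

/-- `Φ_m` divides `1 - q^k` only once, since `q^k - 1` is separable. -/
theorem LocDvd.div_one_sub_pow {m k : ℕ} (hk0 : 0 < k) (hk : m ∣ k) {y : L}
    (hy : LocDvd (cyclotomic m K) 1 y) :
    LocDvd (cyclotomic m K) 0 (y / (1 - qElem K L ^ k)) := by
  obtain ⟨t, rfl⟩ := hk
  have h1 : cyclotomic m K ∣ (X ^ (m * t) - 1 : K[X]) := by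
    refine (cyclotomic.dvd_X_pow_sub_one m K).trans ?_
    rw [pow_mul]
    simpa using sub_dvd_pow_sub_pow (X ^ m : K[X]) 1 t
  obtain ⟨h, hh⟩ := h1
  have hsep : (X ^ (m * t) - 1 : K[X]).Separable := by
    have := separable_X_pow_sub_C (1 : K) (n := m * t) (by exact_mod_cast hk0.ne') one_ne_zero
    simpa using this
  rw [hh] at hsep
  obtain ⟨f, g, hg, e⟩ := hy
  refine ⟨-f, g * h, hg.mul_left hsep.isCoprime.symm, ?_⟩
  have hne : 1 - qElem K L ^ (m * t) ≠ 0 := by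
    have := qElem_zpow_ne_one (K := K) (L := L) (z := (m * t : ℕ)) (by exact_mod_cast hk0.ne')
    rw [zpow_natCast] at this
    exact sub_ne_zero.2 this.symm
  have hh' : 1 - qElem K L ^ (m * t) =
      -(algebraMap K[X] L (cyclotomic m K) * algebraMap K[X] L h) := by
    rw [← map_mul, ← hh]; simp [qElem]
  rw [mul_div_assoc', div_eq_iff hne, hh']
  simp only [map_mul, map_neg, pow_zero, pow_one, one_mul] at *
  linear_combination algebraMap K[X] L h * e

end Cyclotomic

/-! ### Monomials in `q` -/

section Monomials

variable {K : Type*} [Field K] {L : Type*} [Field L] [Algebra K[X] L]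

variable (L) in
/-- The monomial `c q^z` with constant `c` and integer exponent `z`. -/
noncomputable def qMonomial (c : K) (z : ℤ) : L := constElem L c * qElem K L ^ z

variable [FaithfulSMul K[X] L]

theorem qMonomial_mul_pow (c : K) (z : ℤ) (d i : ℕ) :
    qMonomial L c z * (qElem K L ^ d) ^ i = qMonomial L c (z + d * i) := by
  rw [qMonomial, qMonomial, zpow_add₀ qElem_ne_zero, ← pow_mul, mul_assoc]
  norm_cast

theorem qMonomial_one_mul_div (w : ℤ) (c : K) (z : ℤ) (d : ℕ) :
    qMonomial L (1 : K) w * qElem K L ^ d / qMonomial L c z = qMonomial L c⁻¹ (w + d - z) := by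
  rw [qMonomial, qMonomial, qMonomial, constElem_one, constElem_inv, zpow_sub₀ qElem_ne_zero,
    zpow_add₀ qElem_ne_zero, zpow_natCast]
  ring

theorem qMonomial_ne_zero {c : K} (hc : c ≠ 0) (z : ℤ) : qMonomial L c z ≠ 0 :=
  mul_ne_zero (constElem_ne_zero hc) (zpow_ne_zero _ qElem_ne_zero)

theorem locUnit_qMonomial {m : ℕ} (hm : 0 < m) {c : K} (hc : c ≠ 0) (z : ℤ) :
    LocUnit (cyclotomic m K) (qMonomial L c z) :=
  (locUnit_constElem hc).mul ((locUnit_qElem hm).zpow _)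

theorem locCongr_qMonomial {m : ℕ} (hm : 0 < m) {c : K} (hc : c ≠ 0) {z z' : ℤ}
    (h : (m : ℤ) ∣ z' - z) :
    LocCongr (cyclotomic m K) (qMonomial L c z) (qMonomial L c z') := by
  refine ⟨(locUnit_qMonomial hm hc z).1, (locUnit_qMonomial hm hc z').1, ?_⟩
  have e : qMonomial L c z - qMonomial L c z' =
      qMonomial L c z * (1 - qElem K L ^ (z' - z)) := by
    have := zpow_ne_zero z (qElem_ne_zero (K := K) (L := L))
    rw [qMonomial, qMonomial, zpow_sub₀ qElem_ne_zero]
    field_simp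
  rw [e]
  exact (locUnit_qMonomial hm hc z).1.mul_left (locDvd_one_sub_qElem_zpow hm h)

theorem locDvd_one_sub_qMonomial {m : ℕ} (hm : 0 < m) {z : ℤ} (h : (m : ℤ) ∣ z) :
    LocDvd (cyclotomic m K) 1 (1 - qMonomial L (1 : K) z) := by
  rw [qMonomial, constElem_one, one_mul]
  exact locDvd_one_sub_qElem_zpow hm h

variable [CharZero K]

theorem qMonomial_one_ne_one {z : ℤ} (hz : z ≠ 0) : qMonomial L (1 : K) z ≠ 1 := by
  rw [qMonomial, constElem_one, one_mul]
  exact qElem_zpow_ne_one hz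

theorem qMonomial_ne_one {c : K} (hc : c ≠ 1) (hc0 : c ≠ 0) (z : ℤ) : qMonomial L c z ≠ 1 :=
  (sub_ne_zero.1 (locUnit_one_sub_zpow one_pos hc0 (Or.inl (by simpa using hc))).ne_zero).symm

end Monomials

/-! ### Second-order congruences of very-well-poised terms -/

section Families

variable {R L : Type*} [CommRing R] [Field L] [Algebra R L] {P : R}

theorem LocBiCongr.wellPoised {α y : Bool → Bool → L} {p : L} {k : ℕ} (hα : LocBiCongr P α)
    (hp : LocDvd P 0 p) (hy : LocBiCongr P y) (hu : ∀ s t, LocUnit P (y s t))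
    (hden : ∀ i < k, ∀ s t, LocUnit P (1 - α s t * p / y s t * p ^ i)) :
    LocBiCongr P fun s t => wellPoised (α s t) p (y s t) k := by
  have hpow : ∀ i, LocBiCongr P fun _ _ => p ^ i := fun i => (LocBiCongr.const hp).pow i
  have h1 : LocBiCongr P fun s t => qPochhammer (y s t) p k :=
    .prod fun i _ => (LocBiCongr.const locDvd_one).sub (hy.mul (hpow i))
  have h2 : LocBiCongr P fun s t => (qPochhammer (α s t * p / y s t) p k)⁻¹ := by
    refine LocBiCongr.inv (LocBiCongr.prod fun i _ => (LocBiCongr.const locDvd_one).sub ?_)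
      fun s t => LocUnit.prod fun i hi => hden i (mem_range.1 hi) s t
    simp only [div_eq_mul_inv]
    exact ((hα.mul (.const hp)).mul (hy.inv hu)).mul (hpow i)
  simpa only [QSupercongruence.wellPoised, div_eq_mul_inv] using h1.mul h2

/-- The six conditions on denominators say that `(α p / x; p)_k` is a unit for every parameter
`x`. -/
theorem LocBiCongr.vwpTerm {α e : Bool → Bool → L} {p b₁ b₂ b₃ b₄ : L} {k : ℕ}
    (hα : LocBiCongr P α) (hp : LocDvd P 0 p) (he : LocBiCongr P e)
    (hαu : ∀ s t, LocUnit P (α s t)) (heu : ∀ s t, LocUnit P (e s t))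
    (hb₁ : LocUnit P b₁) (hb₂ : LocUnit P b₂) (hb₃ : LocUnit P b₃) (hb₄ : LocUnit P b₄)
    (hα' : ∀ i < k, ∀ s t, LocUnit P (1 - α s t * p / α s t * p ^ i))
    (he' : ∀ i < k, ∀ s t, LocUnit P (1 - α s t * p / e s t * p ^ i))
    (hb₁' : ∀ i < k, ∀ s t, LocUnit P (1 - α s t * p / b₁ * p ^ i))
    (hb₂' : ∀ i < k, ∀ s t, LocUnit P (1 - α s t * p / b₂ * p ^ i))
    (hb₃' : ∀ i < k, ∀ s t, LocUnit P (1 - α s t * p / b₃ * p ^ i))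
    (hb₄' : ∀ i < k, ∀ s t, LocUnit P (1 - α s t * p / b₄ * p ^ i)) :
    LocBiCongr P fun s t => vwpTerm p (α s t) b₁ b₂ b₃ b₄ (e s t) k := by
  have hc : ∀ {x : L}, LocUnit P x → LocBiCongr P fun _ _ => x := fun h => .const h.1
  have hP := LocBiCongr.const (P := P) hp
  have hz : LocBiCongr P fun s t => α s t ^ 2 * p ^ 2 / (b₁ * b₂ * b₃ * b₄ * e s t) := by
    simp only [div_eq_mul_inv]
    exact ((hα.pow 2).mul (hP.pow 2)).mul
      (LocBiCongr.inv ((hc (((hb₁.mul hb₂).mul hb₃).mul hb₄)).mul he)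
        fun s t => (((hb₁.mul hb₂).mul hb₃).mul hb₄).mul (heu s t))
  exact (((LocBiCongr.const locDvd_one).sub (hα.mul (hP.pow _))).mul
    ((((((hα.wellPoised hp hα hαu hα').mul
      (hα.wellPoised hp (hc hb₁) (fun _ _ => hb₁) hb₁')).mul
      (hα.wellPoised hp (hc hb₂) (fun _ _ => hb₂) hb₂')).mul
      (hα.wellPoised hp (hc hb₃) (fun _ _ => hb₃) hb₃')).mul
      (hα.wellPoised hp (hc hb₄) (fun _ _ => hb₄) hb₄')).mul
      (hα.wellPoised hp he heu he'))).mul (hz.pow k)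

end Families

/-! ### One period of the sum -/

section Application

variable {K : Type*} [Field K] {L : Type*} [Field L] [Algebra K[X] L] {m d r : ℕ} {a b : K}

/-- The exponents `-1` and `-d r`; they agree modulo `m` when `d r ≡ 1`. -/
def leadExponent (d r : ℕ) (s : Bool) : ℤ := if s then -1 else -(d * r)

variable (L) in
/-- The very-well-poised term in base `q^d` whose leading parameter is `q^w` and whose other
parameters are `a q⁻¹, q⁻¹ / a, b q⁻¹, q⁻¹ / b` and `q^v`. -/
noncomputable def paramTerm (d : ℕ) (a b : K) (w v : ℤ) (k : ℕ) : L :=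
  vwpTerm (qElem K L ^ d) (qMonomial L (1 : K) w) (qMonomial L a (-1)) (qMonomial L a⁻¹ (-1))
    (qMonomial L b (-1)) (qMonomial L b⁻¹ (-1)) (qMonomial L (1 : K) v) k

theorem leadExponent_sub_dvd (hr : (m : ℤ) ∣ d * r - 1) (s t : Bool) :
    (m : ℤ) ∣ leadExponent d r s - leadExponent d r t := by
  obtain ⟨c, hc⟩ := hr
  cases s <;> cases t <;> simp only [leadExponent, if_true, if_false, Bool.false_eq_true]
  · exact ⟨0, by ring⟩
  · exact ⟨-c, by linarith⟩
  · exact ⟨c, by linarith⟩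
  · exact ⟨0, by ring⟩

theorem not_dvd_mul_of_lt (hmd : m.Coprime d) {t : ℕ} (h0 : 0 < t) (ht : t < m) :
    ¬ (m : ℤ) ∣ d * t := by
  intro h
  have h1 : m ∣ d * t := by exact_mod_cast h
  exact absurd (Nat.le_of_dvd h0 (hmd.dvd_of_dvd_mul_left h1)) (by omega)

theorem qMonomial_leadExponent_false :
    qMonomial L (1 : K) (leadExponent d r false) = ((qElem K L ^ d) ^ r)⁻¹ := by
  simp only [leadExponent, qMonomial, constElem_one, ← pow_mul, zpow_neg, one_mul,
    Bool.false_eq_true, if_false]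
  norm_cast

variable [FaithfulSMul K[X] L]

/-- The parameters `c q⁻¹` and `q⁻¹ / c` multiply to `q⁻²`, whatever `c` is. -/
theorem qMonomial_pair {c : K} (hc : c ≠ 0) (d : ℕ) : qMonomial L (1 : K) (-1) * qElem K L ^ d /
    (qMonomial L c (-1) * qMonomial L c⁻¹ (-1)) = qMonomial L (1 : K) (d + 1) := by
  rw [← div_div, qMonomial_one_mul_div, qMonomial, qMonomial, qMonomial, mul_div_mul_comm,
    div_self (constElem_ne_zero (inv_ne_zero hc)), ← zpow_sub₀ qElem_ne_zero, constElem_one]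
  congr 2
  ring

theorem locDvd_qPochhammer (hm : 0 < m) {c : K} (hc : c ≠ 0) (z : ℤ) (k : ℕ) :
    LocDvd (cyclotomic m K) 0 (qPochhammer (qMonomial L c z) (qElem K L ^ d) k) :=
  LocDvd.prod fun i _ =>
    locDvd_one.sub ((locUnit_qMonomial hm hc z).1.mul_right (((locUnit_qElem hm).pow d).pow i).1)

theorem locDvd_one_qPochhammer (hm : 0 < m) {z : ℤ} {i k : ℕ} (hik : i < k)
    (h : (m : ℤ) ∣ z + d * i) :
    LocDvd (cyclotomic m K) 1 (qPochhammer (qMonomial L (1 : K) z) (qElem K L ^ d) k) := by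
  rw [qPochhammer, ← mul_prod_erase _ _ (mem_range.2 hik), qMonomial_mul_pow]
  exact (locDvd_one_sub_qMonomial hm h).mul_right (LocDvd.prod fun i _ =>
    locDvd_one.sub ((locUnit_qMonomial hm one_ne_zero z).1.mul_right
      (((locUnit_qElem hm).pow d).pow i).1))

theorem locUnit_reversalSign (hm : 0 < m) (j : ℕ) :
    LocUnit (cyclotomic m K) (reversalSign (qElem K L ^ d) j) :=
  LocUnit.prod fun l _ => by
    have h := (((locUnit_qElem (K := K) (L := L) hm).pow d).pow (l + 1)).inv
    exact ⟨h.1.neg, by rw [inv_neg]; exact h.2.neg, neg_ne_zero.2 h.3⟩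

/-- If `2 s ≤ r + 1` and `0 ≤ j ≤ r`, then `j ≥ s` or `r - j ≥ s`, so one of the two products
contains the factor `1 - q^(d s + 1)`. -/
theorem locDvd_one_qPochhammer_mul {s j : ℕ} (hm : 0 < m) (hs0 : 0 < s)
    (hs : (m : ℤ) ∣ d * s + 1) (hsr : 2 * s ≤ r + 1) :
    LocDvd (cyclotomic m K) 1
      (qPochhammer (qMonomial L (1 : K) (d + 1)) (qElem K L ^ d) j *
        qPochhammer (qMonomial L (1 : K) (d + 1)) (qElem K L ^ d) (r - j)) := by
  have hs1 : (m : ℤ) ∣ d + 1 + d * (s - 1 : ℕ) := by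
    rw [Nat.cast_sub hs0]
    convert hs using 1
    push_cast
    ring
  rcases le_or_gt s j with h | h
  · exact (locDvd_one_qPochhammer (i := s - 1) hm (by omega) hs1).mul_right
      (locDvd_qPochhammer hm one_ne_zero _ _)
  · exact (locDvd_qPochhammer hm one_ne_zero _ _).mul_left
      (locDvd_one_qPochhammer (i := s - 1) hm (by omega) hs1)

variable [CharZero K]

/-- For `k ≤ r` all denominators are units at `Φ_m`, so replacing either exponent `-1` by `-d r`
changes the term by a multiple of `Φ_m`, with second-order mixed difference. -/
theorem locBiCongr_paramTerm (hm : 0 < m) (hmd : m.Coprime d) (hrm : r < m)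
    (hr : (m : ℤ) ∣ d * r - 1) (ha0 : a ≠ 0) (hb0 : b ≠ 0) (ha : a ^ m ≠ 1) (hb : b ^ m ≠ 1)
    {k : ℕ} (hk : k ≤ r) :
    LocBiCongr (cyclotomic m K)
      fun s t => paramTerm L d a b (leadExponent d r s) (leadExponent d r t) k := by
  have hone : (1 : K) ≠ 0 := one_ne_zero
  have hmono : ∀ s s' : Bool, LocCongr (cyclotomic m K)
      (qMonomial L (1 : K) (leadExponent d r s)) (qMonomial L (1 : K) (leadExponent d r s')) :=
    fun s s' => locCongr_qMonomial hm hone (leadExponent_sub_dvd hr s' s)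
  have hdenc : ∀ c : K, c ≠ 0 → c ^ m ≠ 1 → ∀ i < k, ∀ s t : Bool, LocUnit (cyclotomic m K)
      (1 - qMonomial L (1 : K) (leadExponent d r s) * qElem K L ^ d / qMonomial L c (-1) *
        (qElem K L ^ d) ^ i) := by
    intro c hc0 hc i _ s t
    rw [qMonomial_one_mul_div, qMonomial_mul_pow]
    exact locUnit_one_sub_zpow hm (inv_ne_zero hc0) (Or.inl (by simpa using hc))
  have hden1 : ∀ i < k, ∀ s t : Bool, LocUnit (cyclotomic m K)
      (1 - qMonomial L (1 : K) (leadExponent d r s) * qElem K L ^ d /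
        qMonomial L (1 : K) (leadExponent d r t) * (qElem K L ^ d) ^ i) := by
    intro i hi s t
    rw [qMonomial_one_mul_div, qMonomial_mul_pow]
    refine locUnit_one_sub_zpow hm (by simp) (Or.inr ⟨by simp, fun h => ?_⟩)
    refine not_dvd_mul_of_lt hmd (Nat.succ_pos i) (by omega) ?_
    have h' := h.sub (leadExponent_sub_dvd hr s t)
    rwa [show leadExponent d r s + d - leadExponent d r t + d * i -
      (leadExponent d r s - leadExponent d r t) = d * ((i + 1 : ℕ) : ℤ) by push_cast; ring] at h'
  have hainv : a⁻¹ ^ m ≠ 1 := by simpa using ha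
  have hbinv : b⁻¹ ^ m ≠ 1 := by simpa using hb
  exact LocBiCongr.vwpTerm (.fst hmono) ((locUnit_qElem hm).pow d).1 (.snd hmono)
    (fun _ _ => locUnit_qMonomial hm hone _) (fun _ _ => locUnit_qMonomial hm hone _)
    (locUnit_qMonomial hm ha0 _) (locUnit_qMonomial hm (inv_ne_zero ha0) _)
    (locUnit_qMonomial hm hb0 _) (locUnit_qMonomial hm (inv_ne_zero hb0) _)
    (fun i hi s _ => hden1 i hi s s) hden1 (hdenc a ha0 ha) (hdenc _ (inv_ne_zero ha0) hainv)
    (hdenc b hb0 hb) (hdenc _ (inv_ne_zero hb0) hbinv)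

theorem qElem_pow_mul_pow_ne_one (hd : 0 < d) (i : ℕ) :
    qElem K L ^ d * (qElem K L ^ d) ^ i ≠ 1 := by
  rw [← pow_succ', ← pow_mul, ← zpow_natCast]
  exact qElem_zpow_ne_one (by positivity)

theorem sum_paramTerm_of_terminating [CharZero L] (hd : 2 ≤ d) (ha0 : a ≠ 0) (hb0 : b ≠ 0)
    (ha : a ≠ 1) (hb : b ≠ 1) (t : Bool) :
    ∑ k ∈ range (r + 1), paramTerm L d a b (leadExponent d r false) (leadExponent d r t) k = 0 := by
  have hp : qElem K L ^ d ≠ 0 := pow_ne_zero _ qElem_ne_zero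
  have hne : ∀ c : K, c ≠ 0 → c ≠ 1 → ∀ i < r, qMonomial L c (-1) * (qElem K L ^ d) ^ i ≠ 1 := by
    intro c h0 h1 i _
    rw [qMonomial_mul_pow]
    exact qMonomial_ne_one h1 h0 _
  have hne' : ∀ i < r, qMonomial L (1 : K) (leadExponent d r t) * (qElem K L ^ d) ^ i ≠ 1 := by
    intro i hi
    rw [qMonomial_mul_pow]
    refine qMonomial_one_ne_one fun h => ?_
    cases t
    · have : (d : ℤ) * i < d * r := by
        have : (0 : ℤ) < d := by omega
        have hi' : (i : ℤ) < r := by exact_mod_cast hi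
        nlinarith
      simp [leadExponent] at h
      omega
    · have h1 : (d : ℤ) ∣ 1 := ⟨i, by simp [leadExponent] at h; omega⟩
      have := Int.le_of_dvd one_pos h1
      omega
  have h1 : ∀ {c : K}, c ≠ 1 → c⁻¹ ≠ 1 := fun h => by simpa using h
  simp only [paramTerm, qMonomial_leadExponent_false]
  exact sum_vwpTerm_reflect hp (qElem_pow_mul_pow_ne_one (by omega)) (qMonomial_ne_zero ha0 _)
    (qMonomial_ne_zero (inv_ne_zero ha0) _) (qMonomial_ne_zero hb0 _)
    (qMonomial_ne_zero (inv_ne_zero hb0) _) (qMonomial_ne_zero one_ne_zero _) r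
    (hne a ha0 ha) (hne _ (inv_ne_zero ha0) (h1 ha)) (hne b hb0 hb)
    (hne _ (inv_ne_zero hb0) (h1 hb)) hne'

/-- Modulo `Φ_m` the sum over `0 ≤ k ≤ r` is antisymmetric under `k ↦ r - k`. -/
theorem locDvd_one_sum_paramTerm [CharZero L] (hm : 0 < m) (hmd : m.Coprime d) (hrm : r < m)
    (hr : (m : ℤ) ∣ d * r - 1) (hd : 2 ≤ d) (ha0 : a ≠ 0) (hb0 : b ≠ 0) (ha : a ^ m ≠ 1)
    (hb : b ^ m ≠ 1) :
    LocDvd (cyclotomic m K) 1 (∑ k ∈ range (r + 1), paramTerm L d a b (-1) (-1) k) := by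
  have ha1 : a ≠ 1 := fun h => ha (by simp [h])
  have hb1 : b ≠ 1 := fun h => hb (by simp [h])
  have h0 := sum_paramTerm_of_terminating (L := L) (r := r) hd ha0 hb0 ha1 hb1 false
  rw [← sub_zero (∑ k ∈ _, _), ← h0, ← sum_sub_distrib]
  refine LocDvd.sum fun k hk => ?_
  exact ((locBiCongr_paramTerm (L := L) hm hmd hrm hr ha0 hb0 ha hb
    (Nat.lt_succ_iff.1 (mem_range.1 hk))).congr true true false false).sub

theorem locUnit_qPochhammer (hm : 0 < m) {c : K} (hc0 : c ≠ 0) (hc : c ^ m ≠ 1) (z : ℤ) (k : ℕ) :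
    LocUnit (cyclotomic m K) (qPochhammer (qMonomial L c z) (qElem K L ^ d) k) :=
  LocUnit.prod fun i _ => by
    rw [qMonomial_mul_pow]
    exact locUnit_one_sub_zpow hm hc0 (Or.inl hc)

theorem locUnit_qPochhammer_base (hm : 0 < m) (hmd : m.Coprime d) {k : ℕ} (hk : k < m) :
    LocUnit (cyclotomic m K) (qPochhammer (qElem K L ^ d) (qElem K L ^ d) k) :=
  LocUnit.prod fun i hi => by
    have hi' := mem_range.1 hi
    rw [← pow_succ', ← pow_mul, ← zpow_natCast]
    refine locUnit_one_sub_qElem_zpow hm ?_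
    exact_mod_cast not_dvd_mul_of_lt hmd (Nat.succ_pos i) (by omega)

/-- Watson's transformation for the series with leading parameter `q⁻¹` and last parameter
`q^(-d r)`. -/
theorem sum_paramTerm_watson (hd : 2 ≤ d) (ha0 : a ≠ 0) (hb0 : b ≠ 0) (ha1 : a ≠ 1)
    (hb1 : b ≠ 1) :
    ∑ k ∈ range (r + 1), paramTerm L d a b (-1) (leadExponent d r false) k =
      ∑ j ∈ range (r + 1), qPochhammer (qMonomial L (1 : K) (-1)) (qElem K L ^ d) (r + 1) *
        (qPochhammer (qMonomial L (1 : K) (d + 1)) (qElem K L ^ d) j *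
          qPochhammer (qMonomial L (1 : K) (d + 1)) (qElem K L ^ d) (r - j)) *
        (qPochhammer (qMonomial L b (-1)) (qElem K L ^ d) j *
            qPochhammer (qMonomial L b⁻¹ (-1)) (qElem K L ^ d) j *
            qPochhammer (qMonomial L (1 : K) (leadExponent d r false)) (qElem K L ^ d) j /
          (qPochhammer (qElem K L ^ d) (qElem K L ^ d) j *
            qPochhammer (qMonomial L a⁻¹ (-1 + d - -1)) (qElem K L ^ d) j *
            qPochhammer (qMonomial L a⁻¹⁻¹ (-1 + d - -1)) (qElem K L ^ d) j *
            qPochhammer (qMonomial L b⁻¹ (-1 + d - -1)) (qElem K L ^ d) r *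
            qPochhammer (qMonomial L b⁻¹⁻¹ (-1 + d - -1)) (qElem K L ^ d) r)) *
        (reversalSign (qElem K L ^ d) j * (qElem K L ^ d) ^ j *
          (qMonomial L (1 : K) (-1) * qElem K L ^ d * (qElem K L ^ d) ^ r /
            (qMonomial L b (-1) * qMonomial L b⁻¹ (-1))) ^ j) := by
  have hp : qElem K L ^ d ≠ 0 := pow_ne_zero _ qElem_ne_zero
  have hne : ∀ c : K, c ≠ 0 → c ≠ 1 → ∀ i,
      qMonomial L (1 : K) (-1) * qElem K L ^ d / qMonomial L c (-1) * (qElem K L ^ d) ^ i ≠ 1 := by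
    intro c h0 h1 i
    rw [qMonomial_one_mul_div, qMonomial_mul_pow]
    exact qMonomial_ne_one (by simpa using h1) (inv_ne_zero h0) _
  have hα : ∀ i, qMonomial L (1 : K) (-1) * qElem K L ^ d * (qElem K L ^ d) ^ i ≠ 1 := by
    intro i
    rw [mul_assoc, ← pow_succ', qMonomial_mul_pow]
    refine qMonomial_one_ne_one fun h => ?_
    have h1 : (d : ℤ) ∣ 1 := ⟨(i + 1 : ℕ), by linarith⟩
    have := Int.le_of_dvd one_pos h1
    omega
  have h1 : ∀ {c : K}, c ≠ 1 → c⁻¹ ≠ 1 := fun h => by simpa using h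
  simp only [paramTerm, qMonomial_leadExponent_false]
  rw [sum_vwpTerm_eq hp (qElem_pow_mul_pow_ne_one (by omega)) (qMonomial_ne_zero one_ne_zero _) hα
    (qMonomial_ne_zero ha0 _) (qMonomial_ne_zero (inv_ne_zero ha0) _) (qMonomial_ne_zero hb0 _)
    (qMonomial_ne_zero (inv_ne_zero hb0) _) (hne a ha0 ha1) (hne _ (inv_ne_zero ha0) (h1 ha1))
    (hne b hb0 hb1) (hne _ (inv_ne_zero hb0) (h1 hb1)), qMonomial_pair ha0, qMonomial_pair hb0]
  simp only [qMonomial_one_mul_div]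

/-- The terminating series with leading parameter `q⁻¹` and last parameter `q^(-d r)` vanishes
modulo `Φ_m^2`: in Watson's transformation the prefactor contains `1 - q^(d r - 1)`, and every term
contains a further factor divisible by `Φ_m`. -/
theorem locDvd_two_sum_paramTerm_watson {s : ℕ} (hm : 0 < m) (hmd : m.Coprime d) (hrm : r < m)
    (hr : (m : ℤ) ∣ d * r - 1) (hd : 2 ≤ d) (ha0 : a ≠ 0) (hb0 : b ≠ 0) (ha : a ^ m ≠ 1)
    (hb : b ^ m ≠ 1) (hs0 : 0 < s) (hs : (m : ℤ) ∣ d * s + 1) (hsr : 2 * s ≤ r + 1) :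
    LocDvd (cyclotomic m K) 2
      (∑ k ∈ range (r + 1), paramTerm L d a b (-1) (leadExponent d r false) k) := by
  have ha1 : a ≠ 1 := fun h => ha (by simp [h])
  have hb1 : b ≠ 1 := fun h => hb (by simp [h])
  have hu : ∀ c : K, c ≠ 0 → c ^ m ≠ 1 → c⁻¹ ≠ 0 ∧ c⁻¹ ^ m ≠ 1 ∧ c⁻¹⁻¹ ≠ 0 ∧ c⁻¹⁻¹ ^ m ≠ 1 :=
    fun c h0 h1 => ⟨by simpa using h0, by simpa using h1, by simpa using h0, by simpa using h1⟩
  obtain ⟨a1, a2, a3, a4⟩ := hu a ha0 ha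
  obtain ⟨b1, b2, b3, b4⟩ := hu b hb0 hb
  have hpu : LocUnit (cyclotomic m K) (qElem K L ^ d) := (locUnit_qElem hm).pow d
  rw [sum_paramTerm_watson hd ha0 hb0 ha1 hb1]
  refine LocDvd.sum fun j hj => ?_
  have hjr : j ≤ r := Nat.lt_succ_iff.1 (mem_range.1 hj)
  have f1 : LocDvd (cyclotomic m K) 1
      (qPochhammer (qMonomial L (1 : K) (-1)) (qElem K L ^ d) (r + 1)) :=
    locDvd_one_qPochhammer hm (Nat.lt_succ_self r) (by rwa [neg_add_eq_sub])
  have f2 := locDvd_one_qPochhammer_mul (K := K) (L := L) (j := j) hm hs0 hs hsr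
  have g1 := locUnit_qPochhammer_base (K := K) (L := L) hm hmd (lt_of_le_of_lt hjr hrm)
  have g2 := locUnit_qPochhammer (L := L) (d := d) hm a1 a2 (-1 + d - -1) j
  have g3 := locUnit_qPochhammer (L := L) (d := d) hm a3 a4 (-1 + d - -1) j
  have g4 := locUnit_qPochhammer (L := L) (d := d) hm b1 b2 (-1 + d - -1) r
  have g5 := locUnit_qPochhammer (L := L) (d := d) hm b3 b4 (-1 + d - -1) r
  have n1 := locDvd_qPochhammer (L := L) (d := d) hm hb0 (-1) j
  have n2 := locDvd_qPochhammer (L := L) (d := d) hm b1 (-1) j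
  have n3 := locDvd_qPochhammer (K := K) (L := L) (d := d) hm one_ne_zero (leadExponent d r false) j
  refine ((f1.mul f2).mul_right ?_).mul_right ?_
  · rw [div_eq_mul_inv]
    exact ((n1.mul_right n2).mul_right n3).mul_right ((((g1.mul g2).mul g3).mul g4).mul g5).2
  · refine (((locUnit_reversalSign hm j).mul (hpu.pow j)).mul (LocUnit.pow (LocUnit.div ?_ ?_) j)).1
    · exact ((locUnit_qMonomial hm one_ne_zero _).mul hpu).mul (hpu.pow r)
    · exact (locUnit_qMonomial hm hb0 _).mul (locUnit_qMonomial hm b1 _)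

/-- The mixed second difference of the sum is a multiple of `Φ_m^2`; two of its four values vanish
identically and a third is a multiple of `Φ_m^2` by Watson's transformation. -/
theorem locDvd_two_sum_paramTerm [CharZero L] {s : ℕ} (hm : 0 < m) (hmd : m.Coprime d)
    (hrm : r < m) (hr : (m : ℤ) ∣ d * r - 1) (hd : 2 ≤ d) (ha0 : a ≠ 0) (hb0 : b ≠ 0)
    (ha : a ^ m ≠ 1) (hb : b ^ m ≠ 1) (hs0 : 0 < s) (hs : (m : ℤ) ∣ d * s + 1)
    (hsr : 2 * s ≤ r + 1) :
    LocDvd (cyclotomic m K) 2 (∑ k ∈ range (r + 1), paramTerm L d a b (-1) (-1) k) := by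
  have ha1 : a ≠ 1 := fun h => ha (by simp [h])
  have hb1 : b ≠ 1 := fun h => hb (by simp [h])
  have h0 := sum_paramTerm_of_terminating (L := L) (r := r) hd ha0 hb0 ha1 hb1
  have h1 : LocDvd (cyclotomic m K) 2 (∑ k ∈ range (r + 1), _) := LocDvd.sum fun k hk =>
    (locBiCongr_paramTerm (L := L) hm hmd hrm hr ha0 hb0 ha hb
      (Nat.lt_succ_iff.1 (mem_range.1 hk))).mixed
  rw [sum_add_distrib, sum_sub_distrib, sum_sub_distrib, h0, h0, sub_zero, add_zero] at h1
  have h2 := h1.add (locDvd_two_sum_paramTerm_watson hm hmd hrm hr hd ha0 hb0 ha hb hs0 hs hsr)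
  simpa [leadExponent] using h2

end Application

/-! ### Several periods of the sum -/

section Periodicity

/-- The factors with indices `K, …, K + j - 1` of `wellPoised α p x (K + j)`. -/
def wellPoisedBlock {F : Type*} [Field F] (α p x : F) (K j : ℕ) : F :=
  qPochhammer (x * p ^ K) p j / qPochhammer (α * p / x * p ^ K) p j

theorem wellPoised_add {F : Type*} [Field F] (α p x : F) (K j : ℕ) :
    wellPoised α p x (K + j) = wellPoised α p x K * wellPoisedBlock α p x K j := by
  rw [wellPoised, wellPoised, wellPoisedBlock, qPochhammer_add, qPochhammer_add, mul_div_mul_comm]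

theorem wellPoisedBlock_zero_left {F : Type*} [Field F] (α p x : F) (j : ℕ) :
    wellPoisedBlock α p x 0 j = wellPoised α p x j := by
  simp [wellPoised, wellPoisedBlock]

variable {K : Type*} [Field K] {L : Type*} [Field L] [Algebra K[X] L]
  [FaithfulSMul K[X] L] {m d r : ℕ} {a b c : K}

theorem locCongr_qPochhammer_shift (hm : 0 < m) (hc : c ≠ 0) (z : ℤ) {k : ℕ} (hk : m ∣ k) (j : ℕ) :
    LocCongr (cyclotomic m K)
      (qPochhammer (qMonomial L c z * (qElem K L ^ d) ^ k) (qElem K L ^ d) j)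
      (qPochhammer (qMonomial L c z * (qElem K L ^ d) ^ 0) (qElem K L ^ d) j) := by
  refine LocCongr.prod fun i _ => (LocCongr.rfl locDvd_one).sub'
    (LocCongr.mul ?_ (LocCongr.rfl (((locUnit_qElem hm).pow d).pow i).1))
  rw [qMonomial_mul_pow, qMonomial_mul_pow]
  refine locCongr_qMonomial hm hc ?_
  have h : (m : ℤ) ∣ k := Int.natCast_dvd_natCast.2 hk
  rw [show z + d * (0 : ℕ) - (z + d * k) = -(d * k : ℤ) by push_cast; ring]
  exact (h.mul_left _).neg_right

theorem locCongr_wellPoisedBlock (hm : 0 < m) (hc : c ≠ 0) (w z : ℤ) {k : ℕ} (hk : m ∣ k) (j : ℕ)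
    (hu : ∀ k, m ∣ k → LocUnit (cyclotomic m K)
      (qPochhammer (qMonomial L c⁻¹ (w + d - z) * (qElem K L ^ d) ^ k) (qElem K L ^ d) j)) :
    LocCongr (cyclotomic m K)
      (wellPoisedBlock (qMonomial L (1 : K) w) (qElem K L ^ d) (qMonomial L c z) k j)
      (wellPoised (qMonomial L (1 : K) w) (qElem K L ^ d) (qMonomial L c z) j) := by
  rw [← wellPoisedBlock_zero_left, wellPoisedBlock, wellPoisedBlock, qMonomial_one_mul_div,
    div_eq_mul_inv, div_eq_mul_inv]
  exact (locCongr_qPochhammer_shift hm hc z hk j).mul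
    ((locCongr_qPochhammer_shift hm (inv_ne_zero hc) _ hk j).inv (hu k hk) (hu 0 (dvd_zero m)))

theorem locDvd_one_leadNumerator (hm : 0 < m) (hr : (m : ℤ) ∣ d * r - 1) {k j : ℕ} (hk : m ∣ k)
    (hj : r < j) :
    LocDvd (cyclotomic m K) 1
      (qPochhammer (qMonomial L (1 : K) (-1) * (qElem K L ^ d) ^ k) (qElem K L ^ d) j) := by
  rw [qMonomial_mul_pow]
  refine locDvd_one_qPochhammer hm hj ?_
  have hk' : (m : ℤ) ∣ d * k := (Int.natCast_dvd_natCast.2 hk).mul_left _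
  rw [show -1 + d * k + d * r = (d * k + (d * r - 1) : ℤ) by ring]
  exact hk'.add hr

variable (K L) in
/-- The factor `(q⁻¹; q^d)_k / (q^d; q^d)_k` of the summand. -/
noncomputable def leadFactor (d k : ℕ) : L :=
  wellPoised (qMonomial L (1 : K) (-1)) (qElem K L ^ d) (qMonomial L (1 : K) (-1)) k

variable (L) in
/-- The product of the four factors of the summand that involve `a` or `b`. -/
noncomputable def abFactor (d : ℕ) (a b : K) (k : ℕ) : L :=
  wellPoised (qMonomial L (1 : K) (-1)) (qElem K L ^ d) (qMonomial L a (-1)) k *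
  wellPoised (qMonomial L (1 : K) (-1)) (qElem K L ^ d) (qMonomial L a⁻¹ (-1)) k *
  wellPoised (qMonomial L (1 : K) (-1)) (qElem K L ^ d) (qMonomial L b (-1)) k *
  wellPoised (qMonomial L (1 : K) (-1)) (qElem K L ^ d) (qMonomial L b⁻¹ (-1)) k

theorem paramTerm_eq (ha0 : a ≠ 0) (hb0 : b ≠ 0) (k : ℕ) :
    paramTerm L d a b (-1) (-1) k =
      (1 - qElem K L ^ (2 * (d : ℤ) * k - 1)) * (leadFactor K L d k ^ 2 * abFactor L d a b k) *
        qElem K L ^ ((2 * d + 3) * k) := by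
  have hq : qElem K L ≠ 0 := qElem_ne_zero
  have ha : constElem L a ≠ 0 := constElem_ne_zero ha0
  have hb : constElem L b ≠ 0 := constElem_ne_zero hb0
  have e1 : qMonomial L (1 : K) (-1) * (qElem K L ^ d) ^ (2 * k) =
      qElem K L ^ (2 * (d : ℤ) * k - 1) := by
    rw [qMonomial_mul_pow, qMonomial, constElem_one, one_mul]
    congr 1
    push_cast
    ring
  have e2 : qMonomial L (1 : K) (-1) ^ 2 * (qElem K L ^ d) ^ 2 /
      (qMonomial L a (-1) * qMonomial L a⁻¹ (-1) * qMonomial L b (-1) * qMonomial L b⁻¹ (-1) *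
        qMonomial L (1 : K) (-1)) = qElem K L ^ (2 * d + 3) := by
    simp only [qMonomial, constElem_one, constElem_inv, zpow_neg, zpow_one]
    field_simp
    ring
  rw [paramTerm, vwpTerm, e1, e2, ← pow_mul, leadFactor, abFactor]
  ring

variable [CharZero K]

theorem locUnit_qPochhammer_shift (hm : 0 < m) (hc0 : c ≠ 0) (hc : c ^ m ≠ 1) (z : ℤ) (k j : ℕ) :
    LocUnit (cyclotomic m K)
      (qPochhammer (qMonomial L c z * (qElem K L ^ d) ^ k) (qElem K L ^ d) j) := by
  rw [qMonomial_mul_pow]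
  exact locUnit_qPochhammer hm hc0 hc _ _

theorem locUnit_qPochhammer_base_shift (hm : 0 < m) (hmd : m.Coprime d) (w : ℤ) {k j : ℕ}
    (hk : m ∣ k) (hj : j < m) :
    LocUnit (cyclotomic m K)
      (qPochhammer (qMonomial L (1 : K)⁻¹ (w + d - w) * (qElem K L ^ d) ^ k)
        (qElem K L ^ d) j) := by
  refine LocUnit.prod fun i hi => ?_
  have hi' := mem_range.1 hi
  rw [qMonomial_mul_pow, qMonomial_mul_pow]
  refine locUnit_one_sub_zpow hm (by simp) (Or.inr ⟨by simp, fun h => ?_⟩)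
  have hk' : (m : ℤ) ∣ d * k := (Int.natCast_dvd_natCast.2 hk).mul_left _
  refine not_dvd_mul_of_lt hmd (Nat.succ_pos i) (by omega) ?_
  have h' := h.sub hk'
  rwa [show w + d - w + d * k + d * i - d * k = d * ((i + 1 : ℕ) : ℤ) by push_cast; ring] at h'

/-- Over a full period the numerator of `(q⁻¹; q^d)_k / (q^d; q^d)_k` acquires a factor `Φ_m`
before the denominator does, so no pole at `Φ_m` ever appears. -/
theorem locDvd_leadFactor_mul (hm : 0 < m) (hmd : m.Coprime d) (hrm : r < m)
    (hr : (m : ℤ) ∣ d * r - 1) (hd : 0 < d) (l : ℕ) :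
    LocDvd (cyclotomic m K) 0 (leadFactor K L d (m * l)) := by
  induction l with
  | zero => simpa [leadFactor, wellPoised, qPochhammer_zero] using locDvd_one
  | succ l ih =>
    rw [leadFactor, mul_add_one, wellPoised_add]
    refine ih.mul_right ?_
    have h1 := locDvd_one_leadNumerator (K := K) (L := L) hm hr (dvd_mul_right m l) hrm
    obtain ⟨t, rfl⟩ : ∃ t, m = t + 1 := ⟨m - 1, by omega⟩
    rw [wellPoisedBlock, qMonomial_one_mul_div, qPochhammer_succ (qMonomial L (1 : K)⁻¹ _ * _),
      ← div_div]
    have h2 := (locUnit_qPochhammer_base_shift (K := K) (L := L) hm hmd (-1) (dvd_mul_right _ l)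
      (Nat.lt_succ_self t)).2
    have e : 1 - qMonomial L (1 : K)⁻¹ (-1 + d - -1) * (qElem K L ^ d) ^ ((t + 1) * l) *
        (qElem K L ^ d) ^ t = 1 - qElem K L ^ (d * ((t + 1) * (l + 1))) := by
      rw [qMonomial_mul_pow, qMonomial_mul_pow, qMonomial, inv_one, constElem_one, one_mul,
        ← zpow_natCast]
      congr 2
      push_cast
      ring
    rw [e]
    refine LocDvd.div_one_sub_pow (by positivity)
      ((dvd_mul_right (t + 1) (l + 1)).mul_left d) ?_
    rw [div_eq_mul_inv]
    exact h1.mul_right h2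

theorem locDvd_one_leadFactor (hm : 0 < m) (hmd : m.Coprime d) (hrm : r < m)
    (hr : (m : ℤ) ∣ d * r - 1) (hd : 0 < d) (l : ℕ) {j : ℕ} (hrj : r < j) (hj : j < m) :
    LocDvd (cyclotomic m K) 1 (leadFactor K L d (m * l + j)) := by
  rw [leadFactor, wellPoised_add]
  refine (locDvd_leadFactor_mul hm hmd hrm hr hd l).mul_left ?_
  rw [wellPoisedBlock, qMonomial_one_mul_div, div_eq_mul_inv]
  exact (locDvd_one_leadNumerator hm hr (dvd_mul_right m l) hrj).mul_right
    (locUnit_qPochhammer_base_shift hm hmd (-1) (dvd_mul_right m l) hj).2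

theorem locDvd_wellPoised_const (hm : 0 < m) (hc0 : c ≠ 0) (hc : c ^ m ≠ 1) (k : ℕ) :
    LocDvd (cyclotomic m K)
      0 (wellPoised (qMonomial L (1 : K) (-1)) (qElem K L ^ d) (qMonomial L c (-1)) k) := by
  rw [wellPoised, qMonomial_one_mul_div, div_eq_mul_inv]
  exact (locDvd_qPochhammer hm hc0 _ _).mul_right
    (locUnit_qPochhammer hm (inv_ne_zero hc0) (by simpa using hc) _ _).2

theorem locDvd_abFactor (hm : 0 < m) (ha0 : a ≠ 0) (hb0 : b ≠ 0) (ha : a ^ m ≠ 1)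
    (hb : b ^ m ≠ 1) (k : ℕ) : LocDvd (cyclotomic m K) 0 (abFactor L d a b k) :=
  (((locDvd_wellPoised_const hm ha0 ha k).mul_right
    (locDvd_wellPoised_const hm (inv_ne_zero ha0) (by simpa using ha) k)).mul_right
    (locDvd_wellPoised_const hm hb0 hb k)).mul_right
    (locDvd_wellPoised_const hm (inv_ne_zero hb0) (by simpa using hb) k)

/-- Beyond the first `r + 1` terms of a period, the two factors `(q⁻¹; q^d)_k / (q^d; q^d)_k` of the
term are both multiples of `Φ_m`. -/
theorem locDvd_two_paramTerm (hm : 0 < m) (hmd : m.Coprime d) (hrm : r < m)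
    (hr : (m : ℤ) ∣ d * r - 1) (hd : 0 < d) (ha0 : a ≠ 0) (hb0 : b ≠ 0) (ha : a ^ m ≠ 1)
    (hb : b ^ m ≠ 1) (l : ℕ) {j : ℕ} (hrj : r < j) (hj : j < m) :
    LocDvd (cyclotomic m K) 2 (paramTerm L d a b (-1) (-1) (m * l + j)) := by
  have hq : LocUnit (cyclotomic m K) (qElem K L) := locUnit_qElem hm
  have h := locDvd_one_leadFactor (K := K) (L := L) hm hmd hrm hr hd l hrj hj
  rw [paramTerm_eq ha0 hb0, pow_two]
  exact ((locDvd_one.sub (hq.zpow _).1).mul_left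
    ((h.mul h).mul_right (locDvd_abFactor hm ha0 hb0 ha hb _))).mul_right (hq.pow _).1

theorem locCongr_constBlock (hm : 0 < m) (hc0 : c ≠ 0) (hc : c ^ m ≠ 1) {k : ℕ} (hk : m ∣ k)
    (j : ℕ) : LocCongr (cyclotomic m K)
      (wellPoisedBlock (qMonomial L (1 : K) (-1)) (qElem K L ^ d) (qMonomial L c (-1)) k j)
      (wellPoised (qMonomial L (1 : K) (-1)) (qElem K L ^ d) (qMonomial L c (-1)) j) :=
  locCongr_wellPoisedBlock hm hc0 _ _ hk j fun _ _ =>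
    locUnit_qPochhammer_shift hm (inv_ne_zero hc0) (by simpa using hc) _ _ _

/-- Shifting the summation index by a multiple of `m` multiplies the summand, modulo `Φ_m`, by a
quantity without pole at `Φ_m`. -/
theorem exists_locCongr_paramTerm (hm : 0 < m) (hmd : m.Coprime d) (hrm : r < m)
    (hr : (m : ℤ) ∣ d * r - 1) (hd : 0 < d) (ha0 : a ≠ 0) (hb0 : b ≠ 0) (ha : a ^ m ≠ 1)
    (hb : b ^ m ≠ 1) (l : ℕ) :
    ∃ D : L, LocDvd (cyclotomic m K) 0 D ∧ ∀ j < m, LocDvd (cyclotomic m K) 1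
      (paramTerm L d a b (-1) (-1) (m * l + j) - D * paramTerm L d a b (-1) (-1) j) := by
  have hq : LocUnit (cyclotomic m K) (qElem K L) := locUnit_qElem hm
  have hD := locDvd_leadFactor_mul (K := K) (L := L) hm hmd hrm hr hd l
  have hab := locDvd_abFactor (L := L) (d := d) hm ha0 hb0 ha hb (m * l)
  have hDi : LocDvd (cyclotomic m K) 0 (leadFactor K L d (m * l) ^ 2 * abFactor L d a b (m * l) *
      qElem K L ^ ((2 * d + 3) * (m * l))) := by
    rw [pow_two]
    exact ((hD.mul_right hD).mul_right hab).mul_right (hq.pow _).1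
  refine ⟨_, hDi, fun j hj => ?_⟩
  have hk := dvd_mul_right m l
  have c0 : LocCongr (cyclotomic m K) (1 - qElem K L ^ (2 * (d : ℤ) * (m * l + j : ℕ) - 1))
      (1 - qElem K L ^ (2 * (d : ℤ) * j - 1)) := by
    refine (LocCongr.rfl locDvd_one).sub' ?_
    have := locCongr_qMonomial (L := L) hm (one_ne_zero (α := K))
      (z := 2 * (d : ℤ) * (m * l + j : ℕ) - 1) (z' := 2 * (d : ℤ) * j - 1)
      ⟨-(2 * d * l), by push_cast; ring⟩
    simpa only [qMonomial, constElem_one, one_mul] using this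
  have c1 : LocCongr (cyclotomic m K) (wellPoisedBlock (qMonomial L (1 : K) (-1)) (qElem K L ^ d)
      (qMonomial L (1 : K) (-1)) (m * l) j) (leadFactor K L d j) :=
    locCongr_wellPoisedBlock hm one_ne_zero _ _ hk j fun k hk' =>
      locUnit_qPochhammer_base_shift hm hmd _ hk' hj
  have hconst : ∀ c : K, c ≠ 0 → c ^ m ≠ 1 → LocCongr (cyclotomic m K)
      (wellPoisedBlock (qMonomial L (1 : K) (-1)) (qElem K L ^ d) (qMonomial L c (-1)) (m * l) j)
      (wellPoised (qMonomial L (1 : K) (-1)) (qElem K L ^ d) (qMonomial L c (-1)) j) :=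
    fun c hc0 hc => locCongr_constBlock hm hc0 hc hk j
  have c2 := (((hconst a ha0 ha).mul (hconst _ (inv_ne_zero ha0) (by simpa using ha))).mul
    (hconst b hb0 hb)).mul (hconst _ (inv_ne_zero hb0) (by simpa using hb))
  have key := ((c0.mul ((c1.mul c1).mul c2)).mul
    (LocCongr.rfl (hq.pow ((2 * d + 3) * j)).1)).sub
  have h := hDi.mul_left key
  rw [paramTerm_eq ha0 hb0, paramTerm_eq ha0 hb0]
  convert h using 1
  simp only [leadFactor, abFactor, wellPoised_add]
  ring

theorem locDvd_one_sum_block [CharZero L] (hm : 0 < m) (hmd : m.Coprime d) (hrm : r < m)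
    (hr : (m : ℤ) ∣ d * r - 1) (hd : 2 ≤ d) (ha0 : a ≠ 0) (hb0 : b ≠ 0) (ha : a ^ m ≠ 1)
    (hb : b ^ m ≠ 1) :
    LocDvd (cyclotomic m K) 1 (∑ k ∈ range m, paramTerm L d a b (-1) (-1) k) := by
  obtain ⟨t, rfl⟩ : ∃ t, m = r + 1 + t := ⟨m - (r + 1), by omega⟩
  rw [sum_range_add]
  refine (locDvd_one_sum_paramTerm hm hmd hrm hr hd ha0 hb0 ha hb).add (LocDvd.sum fun i hi => ?_)
  have hi' := mem_range.1 hi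
  have h := locDvd_two_paramTerm (L := L) hm hmd hrm hr (by omega) ha0 hb0 ha hb 0
    (j := r + 1 + i) (by omega) (by omega)
  rw [mul_zero, zero_add] at h
  exact h.mono one_le_two

theorem locDvd_one_sum_range_mul [CharZero L] (hm : 0 < m) (hmd : m.Coprime d) (hrm : r < m)
    (hr : (m : ℤ) ∣ d * r - 1) (hd : 2 ≤ d) (ha0 : a ≠ 0) (hb0 : b ≠ 0) (ha : a ^ m ≠ 1)
    (hb : b ^ m ≠ 1) (t : ℕ) :
    LocDvd (cyclotomic m K) 1 (∑ k ∈ range (m * t), paramTerm L d a b (-1) (-1) k) := by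
  induction t with
  | zero => simpa using locDvd_zero 1
  | succ t ih =>
    rw [mul_add_one, sum_range_add]
    refine ih.add ?_
    obtain ⟨D, hD, h⟩ := exists_locCongr_paramTerm (L := L) hm hmd hrm hr (by omega) ha0 hb0 ha hb t
    have h1 := LocDvd.sum (s := range m) fun j hj => h j (mem_range.1 hj)
    rw [sum_sub_distrib, ← mul_sum] at h1
    have h2 := h1.add
      (hD.mul_left (locDvd_one_sum_block (L := L) hm hmd hrm hr hd ha0 hb0 ha hb))
    rwa [sub_add_cancel] at h2

theorem locDvd_two_sum_range [CharZero L] {s : ℕ} (hm : 0 < m) (hmd : m.Coprime d)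
    (hrm : r < m) (hr : (m : ℤ) ∣ d * r - 1) (hd : 2 ≤ d) (ha0 : a ≠ 0) (hb0 : b ≠ 0)
    (ha : a ^ m ≠ 1) (hb : b ^ m ≠ 1) (hs0 : 0 < s) (hs : (m : ℤ) ∣ d * s + 1)
    (hsr : 2 * s ≤ r + 1) :
    LocDvd (cyclotomic m K) 2 (∑ k ∈ range m, paramTerm L d a b (-1) (-1) k) := by
  obtain ⟨t, rfl⟩ : ∃ t, m = r + 1 + t := ⟨m - (r + 1), by omega⟩
  rw [sum_range_add]
  refine (locDvd_two_sum_paramTerm hm hmd hrm hr hd ha0 hb0 ha hb hs0 hs hsr).add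
    (LocDvd.sum fun i hi => ?_)
  have hi' := mem_range.1 hi
  have h := locDvd_two_paramTerm (L := L) hm hmd hrm hr (by omega) ha0 hb0 ha hb 0
    (j := r + 1 + i) (by omega) (by omega)
  rwa [mul_zero, zero_add] at h

end Periodicity

/-! ### Divisibility of the numerator -/

section Assembly

theorem truncatedSum_eq {K : Type*} [Field K] {L : Type*} [Field L] [Algebra K[X] L]
    [FaithfulSMul K[X] L] {a b : K} (ha0 : a ≠ 0) (hb0 : b ≠ 0) (n d : ℕ) :
    truncatedSum (constElem L a) (constElem L b) (qElem K L) n d =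
      (∑ k ∈ range n, paramTerm L d a b (-1) (-1) k) * (1 - qElem K L)⁻¹ := by
  have hq : qElem K L ≠ 0 := qElem_ne_zero
  have ha : constElem L a ≠ 0 := constElem_ne_zero ha0
  have hb : constElem L b ≠ 0 := constElem_ne_zero hb0
  rw [truncatedSum, sum_mul]
  refine sum_congr rfl fun k _ => ?_
  have h1 : qMonomial L (1 : K) (-1) = (qElem K L)⁻¹ := by simp [qMonomial, constElem_one]
  have e : ∀ c : K, qMonomial L c (-1) = constElem L c * (qElem K L)⁻¹ := by simp [qMonomial]
  have e0 : (qElem K L)⁻¹ * qElem K L ^ d / (qElem K L)⁻¹ = qElem K L ^ d := by field_simp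
  have e1 : ∀ x : L, x ≠ 0 → (qElem K L)⁻¹ * qElem K L ^ d / (x * (qElem K L)⁻¹) =
      qElem K L ^ d / x := fun x hx => by field_simp
  have e2 : ∀ x : L, x ≠ 0 → (qElem K L)⁻¹ * qElem K L ^ d / (x⁻¹ * (qElem K L)⁻¹) =
      x * qElem K L ^ d := fun x hx => by field_simp
  have e3 : ∀ x : L, (qElem K L)⁻¹ / x = x⁻¹ * (qElem K L)⁻¹ := fun x => by
    rw [div_eq_mul_inv, mul_comm]
  rw [paramTerm_eq ha0 hb0, qInt, leadFactor, abFactor]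
  simp only [wellPoised, h1, e, constElem_inv, e0, e1 _ ha, e1 _ hb, e2 _ ha, e2 _ hb, e3]
  ring

theorem locUnit_one_sub_qElem {K : Type*} [Field K] {L : Type*} [Field L] [Algebra K[X] L]
    [FaithfulSMul K[X] L] [CharZero K] {m : ℕ} (hm : 1 < m) :
    LocUnit (cyclotomic m K) (1 - qElem K L) := by
  have hm1 : ¬ (m : ℤ) ∣ 1 := fun h => by have := Int.le_of_dvd one_pos h; omega
  simpa using locUnit_one_sub_qElem_zpow (L := L) (K := K) (by omega) hm1

theorem exists_inverse_mod {m d : ℕ} (hm : 1 < m) (hmd : m.Coprime d) :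
    ∃ r < m, (m : ℤ) ∣ d * r - 1 := by
  obtain ⟨r, hr, h⟩ := Nat.exists_mul_mod_eq_one_of_coprime hmd.symm hm
  refine ⟨r, hr, ?_⟩
  have h1 : d * r ≡ 1 [MOD m] := by rw [Nat.ModEq, h, Nat.mod_eq_of_lt hm]
  have := (Nat.modEq_iff_dvd.1 h1.symm)
  exact_mod_cast this

theorem isCoprime_cyclotomic {K : Type*} [Field K] [CharZero K] {m n : ℕ} (h : m ≠ n) :
    IsCoprime (cyclotomic m K) (cyclotomic n K) := by
  have := (cyclotomic.isCoprime_rat h).map (mapRingHom (algebraMap ℚ K))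
  simpa using this

theorem qNat_eq_prod_cyclotomic (K : Type*) [Field K] {n : ℕ} (hn : 0 < n) :
    qNat K n = ∏ m ∈ n.divisors.erase 1, cyclotomic m K :=
  (prod_cyclotomic_eq_geom_sum hn K).symm

variable {K : Type*} [Field K] [CharZero K] {a b : K} {n d : ℕ}

theorem cyclotomic_dvd_num (hd : 2 ≤ d) (hnd : n.Coprime d)
    (ha0 : a ≠ 0) (hb0 : b ≠ 0) (ha : ∀ k, 0 < k → a ^ k ≠ 1) (hb : ∀ k, 0 < k → b ^ k ≠ 1)
    {m : ℕ} (hm : 1 < m) (hmn : m ∣ n) :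
    cyclotomic m K ∣ (truncatedSum (constElem (RatFunc K) a) (constElem (RatFunc K) b)
      (qElem K (RatFunc K)) n d).num := by
  obtain ⟨t, rfl⟩ := hmn
  have hmd : m.Coprime d := hnd.coprime_dvd_left (dvd_mul_right m t)
  obtain ⟨r, hrm, hr⟩ := exists_inverse_mod hm hmd
  have hm0 : 0 < m := by omega
  have h1 := locDvd_one_sum_range_mul (L := RatFunc K) hm0 hmd hrm hr hd ha0 hb0
    (ha m hm0) (hb m hm0) t
  have h3 := (h1.mul_right (locUnit_one_sub_qElem (L := RatFunc K) hm).2).dvd_num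
  rwa [← truncatedSum_eq ha0 hb0, pow_one] at h3

/-- If `n = d s + 1`, then `r = n - s` is the inverse of `d` modulo `n`, and `2 s ≤ r + 1` since
`d ≥ 3`. -/
theorem cyclotomic_sq_dvd_num (hn : 1 < n) (hd : 3 ≤ d) (hnd : n.Coprime d) (h1 : n ≡ 1 [MOD d])
    (ha0 : a ≠ 0) (hb0 : b ≠ 0) (ha : ∀ k, 0 < k → a ^ k ≠ 1) (hb : ∀ k, 0 < k → b ^ k ≠ 1) :
    cyclotomic n K ^ 2 ∣ (truncatedSum (constElem (RatFunc K) a) (constElem (RatFunc K) b)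
      (qElem K (RatFunc K)) n d).num := by
  obtain ⟨s, hs⟩ : d ∣ n - 1 := (Nat.modEq_iff_dvd' hn.le).1 h1.symm
  have hs0 : 0 < s := Nat.pos_of_ne_zero fun h => by rw [h] at hs; omega
  have hns : n = d * s + 1 := by omega
  have h3s : 3 * s ≤ d * s := Nat.mul_le_mul_right s hd
  have hn0 : 0 < n := by omega
  have hr : (n : ℤ) ∣ d * (n - s : ℕ) - 1 := by
    refine ⟨d - 1, ?_⟩
    rw [Nat.cast_sub (by omega), hns]
    push_cast
    ring
  have h2 := locDvd_two_sum_range (L := RatFunc K) (s := s) hn0 hnd (by omega) hr (by omega) ha0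
    hb0 (ha n hn0) (hb n hn0) hs0 (by rw [hns]; push_cast; exact dvd_rfl) (by omega)
  have h3 := (h2.mul_right (locUnit_one_sub_qElem (L := RatFunc K) hn).2).dvd_num
  rwa [← truncatedSum_eq ha0 hb0] at h3

theorem prod_cyclotomic_dvd {s : Finset ℕ} {f : K[X]} (h : ∀ m ∈ s, cyclotomic m K ∣ f) :
    ∏ m ∈ s, cyclotomic m K ∣ f :=
  Finset.prod_dvd_of_coprime (fun _ _ _ _ hne => isCoprime_cyclotomic hne) h

theorem qNat_dvd {f : K[X]} (hn : 0 < n) (h : ∀ m, 1 < m → m ∣ n → cyclotomic m K ∣ f) :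
    qNat K n ∣ f := by
  rw [qNat_eq_prod_cyclotomic K hn]
  refine prod_cyclotomic_dvd fun m hm => ?_
  have h1 := mem_erase.1 hm
  have h2 := Nat.mem_divisors.1 h1.2
  have := Nat.pos_of_dvd_of_pos h2.1 hn
  exact h m (by omega) h2.1

theorem qNat_mul_cyclotomic_dvd {f : K[X]} (hn : 1 < n)
    (h : ∀ m, 1 < m → m ∣ n → cyclotomic m K ∣ f) (h2 : cyclotomic n K ^ 2 ∣ f) :
    qNat K n * cyclotomic n K ∣ f := by
  have hmem : n ∈ n.divisors.erase 1 :=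
    mem_erase.2 ⟨hn.ne', Nat.mem_divisors_self n (by omega)⟩
  rw [qNat_eq_prod_cyclotomic K (by omega), ← mul_prod_erase _ _ hmem, mul_right_comm, ← pow_two]
  refine IsCoprime.mul_dvd ?_ h2 (prod_cyclotomic_dvd fun m hm => ?_)
  · exact (IsCoprime.prod_right fun m hm => isCoprime_cyclotomic (mem_erase.1 hm).1.symm).pow_left
  · have h1 := mem_erase.1 (mem_erase.1 hm).2
    have h2 := Nat.mem_divisors.1 h1.2
    have := Nat.pos_of_dvd_of_pos h2.1 (by omega)
    exact h m (by omega) h2.1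

theorem paramField_X_pow_ne_one (i : Fin 2) {k : ℕ} (hk : 0 < k) :
    algebraMap (MvPolynomial (Fin 2) ℚ) ParamField (MvPolynomial.X i) ^ k ≠ 1 := by
  rw [← map_pow, ← map_one (algebraMap (MvPolynomial (Fin 2) ℚ) ParamField)]
  intro h
  have h1 := congrArg (MvPolynomial.eval 0) (IsFractionRing.injective _ ParamField h)
  simp [hk.ne'] at h1

theorem paramField_X_ne_zero (i : Fin 2) :
    algebraMap (MvPolynomial (Fin 2) ℚ) ParamField (MvPolynomial.X i) ≠ 0 :=
  (map_ne_zero_iff _ (IsFractionRing.injective _ ParamField)).2 (MvPolynomial.X_ne_zero i)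

end Assembly
end QSupercongruence

theorem theorem1p2 (n d : ℕ) (hn : 1 < n) (hd : 3 ≤ d) (hnd : Nat.gcd n d = 1) :
    (n ≡ 1 [MOD d] →
      QSupercongruence.RatCongr
        (QSupercongruence.qNat QSupercongruence.ParamField n *
          Polynomial.cyclotomic n QSupercongruence.ParamField)
        (QSupercongruence.truncatedSum QSupercongruence.indA QSupercongruence.indB
          QSupercongruence.indQ n d) 0) ∧
    (¬ n ≡ 1 [MOD d] →
      QSupercongruence.RatCongr
        (QSupercongruence.qNat QSupercongruence.ParamField n)
        (QSupercongruence.truncatedSum QSupercongruence.indA QSupercongruence.indB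
          QSupercongruence.indQ n d) 0) := by
  open QSupercongruence in
  have hA : indA = constElem (RatFunc ParamField)
      (algebraMap (MvPolynomial (Fin 2) ℚ) ParamField (MvPolynomial.X 0)) := by
    rw [indA, constElem, RatFunc.algebraMap_C]
  have hB : indB = constElem (RatFunc ParamField)
      (algebraMap (MvPolynomial (Fin 2) ℚ) ParamField (MvPolynomial.X 1)) := by
    rw [indB, constElem, RatFunc.algebraMap_C]
  have hQ : indQ = qElem ParamField (RatFunc ParamField) := by
    rw [indQ, qElem, RatFunc.algebraMap_X]
  have hpow := fun (i : Fin 2) (k : ℕ) (hk : 0 < k) => paramField_X_pow_ne_one i hk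
  have h1 := fun (m : ℕ) (hm : 1 < m) (hmn : m ∣ n) =>
    cyclotomic_dvd_num (n := n) (d := d) (by omega) hnd (paramField_X_ne_zero 0)
      (paramField_X_ne_zero 1) (hpow 0) (hpow 1) hm hmn
  rw [RatCongr, RatCongr, sub_zero, hA, hB, hQ]
  exact ⟨fun h => qNat_mul_cyclotomic_dvd hn h1 (cyclotomic_sq_dvd_num hn hd hnd h
    (paramField_X_ne_zero 0) (paramField_X_ne_zero 1) (hpow 0) (hpow 1)),
    fun _ => qNat_dvd (by omega) h1⟩
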